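/- Let $f_0,f_\theta$ be probability densities with respect to a common $\sigma$-finite measure such that $D(f_\theta\|f_0)$ and $D(f_0\|f_\theta)$ are both finite and positive, where $D(f\|g)=\int f\log(f/g)$. Let $X_1,X_2,\dots$ be independent; under $\mathbb P_\gamma$ the variable $X_n$ has density $f_0$ for $n<\gamma$ and $f_\theta$ for $n\ge\gamma$ ($1\le\gamma\le\infty$; under $\mathbb P_\infty$ all have density $f_0$). Put $\ell(x)=\log\frac{f_\theta(x)}{f_0(x)}$. CuSum: $C_0=0$, $C_{n}=(C_{n-1}+\ell(X_{n}))^+$, $\tau_C=\inf\{n\ge1: C_n\ge A\}$, every observation is used ($S_n=1$). DECuSum with parameters $\mu>0$, $h\in[0,\infty]$: with $x^{h+}=\max\{x,-h\}$ ($x^{h+}=x$ if $h=\infty$), $W_0=0$ and for $n\ge0$: if $W_n\ge 0$ then $S_{n+1}=1$ and $W_{n+1}=(W_n+\ell(X_{n+1}))^{h+}$; if $W_n<0$ then $S_{n+1}=0$ and $W_{n+1}=\min\{W_n+\mu,0\}$. The recursion defines $W_n,S_n$ for all $n$, and $\tau_W=\inf\{n\ge1: W_n\ge A\}$. For a test with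 stopping time $\tau$ and observation indicators $S_n$, let $\mathcal I_n$ be the $\sigma$-algebra generated by $X_k^{(S_k)}$, $1\le k\le n$ (equal to $X_k$ if $S_k=1$, absent if $S_k=0$), and $$\mathsf{FAR}=\frac1{\mathbb E_\infty[\tau]},\qquad \mathsf{PDC}=\limsup_{\gamma\to\infty}\mathbb E_\gamma\Big[\frac1\gamma\sum_{n=1}^{\gamma-1}S_n\Big],\qquad \mathsf{WADD}=\sup_{1\le\gamma<\infty}\operatorname{ess\,sup}\,\mathbb E_\gamma[(\tau-\gamma)^+\mid\mathcal I_{\gamma-1}].$$ Let $\tau_-=\inf\{n\ge1:\sum_{k=1}^n\ell(X_k)<0\}$ and let $Y=\sum_{k=1}^{\tau_-}\ell(X_k)$ be the ladder height. Theorem. Let $\mu>0$ be fixed and let $A=|\log\alpha|$. (1) If $0\le h<\infty$, then for every $0<\alpha\le1$ $$\mathsf{FAR}(\tau_W)\le\mathsf{FAR}(\tau_C)\le\alpha;$$ the expectations $\mathbb E_\infty[\tau_-]$ and $\mathbb E_\infty[\lceil|Y^{h+}|/\mu\rceil]$ are finite, and (for every threshold) $$\mathsf{PDC}(\tau_W)=\frac{\mathbb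 E_\infty[\tau_-]}{\mathbb E_\infty[\tau_-]+\mathbb E_\infty[\lceil|Y^{h+}|/\mu\rceil]};$$ and, as $\alpha\to0$ with $\mu,h$ fixed, $$\mathsf{WADD}(\tau_W)\sim\mathsf{WADD}(\tau_C)\sim\frac{|\log\alpha|}{D(f_\theta\|f_0)}.$$ (2) If $h=\infty$, then $\mathsf{PDC}(\tau_W)\le\dfrac{\mu}{\mu+D(f_0\|f_\theta)}$. -/

import Mathlib

open MeasureTheory Filter Topology
open scoped ENNReal NNReal Asymptotics

noncomputable section

namespace QCD

variable {𝓧 : Type*} [MeasurableSpace 𝓧]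

/-- `f` is a probability density function with respect to the reference measure `ν`. -/
structure IsPdf (ν : Measure 𝓧) (f : 𝓧 → ℝ) : Prop where
  measurable : Measurable f
  nonneg : ∀ x, 0 ≤ f x
  lintegral_eq_one : ∫⁻ x, ENNReal.ofReal (f x) ∂ν = 1

/-- The distribution with density `f` with respect to `ν`. -/
def law (ν : Measure 𝓧) (f : 𝓧 → ℝ) : Measure 𝓧 :=
  ν.withDensity fun x => ENNReal.ofReal (f x)

/-- The law of the observation sequence with change point `γ` (`γ = ⊤`: no change). The `n`-th
observation `X_n`, `n ≥ 1`, is the coordinate `ω (n - 1)` of `ω : ℕ → 𝓧`. The observations are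
independent, `X_n` has density `f0` if `n < γ` and density `f1` if `n ≥ γ`. -/
def changeLaw (ν : Measure 𝓧) (f0 f1 : 𝓧 → ℝ) (γ : ℕ∞) : Measure (ℕ → 𝓧) :=
  Measure.infinitePi fun i : ℕ => if ((i + 1 : ℕ) : ℕ∞) < γ then law ν f0 else law ν f1

/-- The law of the observation sequence when the change never occurs. -/
def noChangeLaw (ν : Measure 𝓧) (f0 f1 : 𝓧 → ℝ) : Measure (ℕ → 𝓧) :=
  changeLaw ν f0 f1 ⊤

/-- The log-likelihood ratio `log (f1 x / f0 x)`. -/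
def logLR (f0 f1 : 𝓧 → ℝ) (x : 𝓧) : ℝ := Real.log (f1 x / f0 x)

/-- `inf {n ≥ 1 : p n}`, with `inf ∅ = ∞`. -/
def firstTime (p : ℕ → Prop) : ℕ∞ := ⨅ (n : ℕ) (_ : 1 ≤ n ∧ p n), (n : ℕ∞)

/-! ### Performance metrics

A procedure consists of a stopping time `τ : (ℕ → 𝓧) → ℕ∞` and of the indicators `S n`, `n ≥ 1`,
with `S n ω = 1` if `X_n` is used for decision making and `S n ω = 0` if it is skipped. -/

/-- The information available at time `n`: the σ-algebra generated by `X_k^{(S_k)}`, `1 ≤ k ≤ n`,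
which is `X_k` if `S_k = 1` and is a symbol for "absent" otherwise. -/
@[reducible]
def info (S : ℕ → (ℕ → 𝓧) → ℕ) (n : ℕ) : MeasurableSpace (ℕ → 𝓧) :=
  ⨆ (k : ℕ) (_ : k < n), MeasurableSpace.comap
    (fun ω : ℕ → 𝓧 => if S (k + 1) ω = 1 then (Sum.inl (ω k) : 𝓧 ⊕ Unit) else Sum.inr ())
    inferInstance

/-- False alarm rate `1 / E_∞[τ]`. -/
def FAR (ν : Measure 𝓧) (f0 f1 : 𝓧 → ℝ) (τ : (ℕ → 𝓧) → ℕ∞) : ℝ≥0∞ :=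
  1 / ∫⁻ ω, (τ ω : ℝ≥0∞) ∂(noChangeLaw ν f0 f1)

/-- Pre-change duty cycle `limsup_{γ → ∞} E_γ[(1/γ) ∑_{n=1}^{γ-1} S_n]`. -/
def PDC (ν : Measure 𝓧) (f0 f1 : 𝓧 → ℝ) (S : ℕ → (ℕ → 𝓧) → ℕ) : ℝ≥0∞ :=
  limsup (fun γ : ℕ =>
    ∫⁻ ω, ((∑ n ∈ Finset.Ico 1 γ, S n ω : ℕ) : ℝ≥0∞) / (γ : ℝ≥0∞) ∂(changeLaw ν f0 f1 γ)) atTop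

/-- Worst-case average detection delay
`sup_{γ ≥ 1} ess sup E_γ[(τ - γ)^+ | I_{γ-1}]` (the subtraction in `ℝ≥0∞` is truncated). -/
def WADD (ν : Measure 𝓧) (f0 f1 : 𝓧 → ℝ) (τ : (ℕ → 𝓧) → ℕ∞) (S : ℕ → (ℕ → 𝓧) → ℕ) : ℝ≥0∞ :=
  ⨆ (γ : ℕ) (_ : 1 ≤ γ),
    essSup (condLExp (info S (γ - 1)) (changeLaw ν f0 f1 γ)
      (fun ω => (τ ω : ℝ≥0∞) - (γ : ℝ≥0∞))) (changeLaw ν f0 f1 γ)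

/-! ### The CuSum test -/

/-- The CuSum statistic `C_0 = 0`, `C_{n+1} = (C_n + log (f1 X_{n+1} / f0 X_{n+1}))^+`. -/
def cusum (f0 f1 : 𝓧 → ℝ) : ℕ → (ℕ → 𝓧) → ℝ
  | 0, _ => 0
  | n + 1, ω => max (cusum f0 f1 n ω + logLR f0 f1 (ω n)) 0

/-- The CuSum stopping time `inf {n ≥ 1 : C_n ≥ A}`. -/
def cusumTime (f0 f1 : 𝓧 → ℝ) (A : ℝ) (ω : ℕ → 𝓧) : ℕ∞ :=
  firstTime fun n => A ≤ cusum f0 f1 n ω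

/-- The CuSum test uses every observation. -/
def cusumControl (_ : ℕ) (_ : ℕ → 𝓧) : ℕ := 1

/-! ### The DE-CuSum test -/

/-- `x^{h+} = max {x, -h}`, with `x^{h+} = x` if `h = ∞`. -/
def trunc (h : ℝ≥0∞) (x : ℝ) : ℝ := if h = ∞ then x else max x (-h.toReal)

/-- The DE-CuSum statistic `W_n`: the next observation is used if and only if `W_n ≥ 0`. -/
def decusum (f0 f1 : 𝓧 → ℝ) (μ : ℝ) (h : ℝ≥0∞) : ℕ → (ℕ → 𝓧) → ℝ
  | 0, _ => 0
  | n + 1, ω =>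
    if 0 ≤ decusum f0 f1 μ h n ω then trunc h (decusum f0 f1 μ h n ω + logLR f0 f1 (ω n))
    else min (decusum f0 f1 μ h n ω + μ) 0

/-- The DE-CuSum control: `S_{n+1} = 1` if `W_n ≥ 0` and `S_{n+1} = 0` otherwise
(the value at `0` plays no role). -/
def decusumControl (f0 f1 : 𝓧 → ℝ) (μ : ℝ) (h : ℝ≥0∞) : ℕ → (ℕ → 𝓧) → ℕ
  | 0, _ => 0
  | n + 1, ω => if 0 ≤ decusum f0 f1 μ h n ω then 1 else 0

/-- The DE-CuSum stopping time `inf {n ≥ 1 : W_n ≥ A}`. -/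
def decusumTime (f0 f1 : 𝓧 → ℝ) (μ : ℝ) (h : ℝ≥0∞) (A : ℝ) (ω : ℕ → 𝓧) : ℕ∞ :=
  firstTime fun n => A ≤ decusum f0 f1 μ h n ω

/-! ### Ladder variables -/

/-- The random walk `∑_{k=1}^n log (f1 X_k / f0 X_k)`. -/
def walk (f0 f1 : 𝓧 → ℝ) (n : ℕ) (ω : ℕ → 𝓧) : ℝ := ∑ i ∈ Finset.range n, logLR f0 f1 (ω i)

/-- The ladder epoch `τ₋ = inf {n ≥ 1 : walk n < 0}`. -/
def ladderTime (f0 f1 : 𝓧 → ℝ) (ω : ℕ → 𝓧) : ℕ∞ := firstTime fun n => walk f0 f1 n ω < 0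

/-- The ladder height: the walk at time `τ₋` (the value where `τ₋ = ∞` plays no role, this being a
null event). -/
def ladderHeight (f0 f1 : 𝓧 → ℝ) (ω : ℕ → 𝓧) : ℝ := walk f0 f1 (ladderTime f0 f1 ω).toNat ω

/-- `E_∞[τ₋]`. -/
def meanOn (ν : Measure 𝓧) (f0 f1 : 𝓧 → ℝ) : ℝ≥0∞ :=
  ∫⁻ ω, (ladderTime f0 f1 ω : ℝ≥0∞) ∂(noChangeLaw ν f0 f1)

/-- `E_∞[⌈|(ladder height)^{h+}| / μ⌉]`. -/
def meanOff (ν : Measure 𝓧) (f0 f1 : 𝓧 → ℝ) (μ : ℝ) (h : ℝ≥0∞) : ℝ≥0∞ :=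
  ∫⁻ ω, (⌈|trunc h (ladderHeight f0 f1 ω)| / μ⌉₊ : ℝ≥0∞) ∂(noChangeLaw ν f0 f1)

end QCD

end

/-!
All statements reduce to one-step computations with two kinds of tools.

*Independence.* A sequence with change point `k + 1` is obtained by splicing, at time `k`, an
i.i.d. pre-change sequence and an independent i.i.d. post-change sequence
(`measurePreserving_splice_changeLaw`). Conditioning on the past, restarting a recursion and the
renewal property are all applications of Fubini's theorem to this splicing map.

*Lyapunov functions.* CuSum, DE-CuSum and the random walk are recursions driven by an i.i.d.
sequence, and mean hitting times are compared with functions of the state whose drift is known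
(`lintegral_hitTime_le`, `le_lintegral_hitTime`):
* `e^w 1{w > 0}` gains at most `1` per step of CuSum before the change, which gives
  `E_∞[τ_C] ≥ e^A` and hence the bound on the false alarm rate; DE-CuSum stays below CuSum, so that
  its false alarm rate is smaller.
* `w + e^{-w}` gains at most `D(f1‖f0)` per step of CuSum after the change, which gives
  `E_1[τ_C] ≥ (A - 1) / D(f1‖f0)`. With change point `1` this bounds both worst-case delays from
  below.
* From every state in `[-h, A)`, DE-CuSum reaches `A` after the change in mean time at most
  `(A + M + h) / δ_M + c`, where `δ_M → D(f1‖f0)` is the mean of the log-likelihood ratio truncated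
  at `M` and `c` does not depend on `A` (`exists_lintegral_hitTime_decusum_le`). The reason is that
  the number of excursions below `0` has bounded mean and each of them has bounded length. CuSum is
  the case `h = 0`, so this one estimate bounds both delays from above.
* A linear function shows that the ladder epoch has finite mean before the change.

*Duty cycle.* For finite `h` the statistic consists of independent cycles, each made of a ladder
epoch of the walk followed by the skipped observations. Conditioning on the beginning of the current
cycle writes the mean numbers of used and of skipped observations as convolutions with the same
renewal probabilities (`lintegral_reward`), and a Cesàro argument gives the ratio
(`tendsto_average_of_renewal`). For `h = ∞` the mean of `W_N` is at most
`μ (N - n) - D(f0‖f1) n`, where `n` is the mean number of used observations, while it is at least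
`-o(N)`: this yields the bound on the duty cycle without any renewal theory.
-/

noncomputable section

set_option linter.unusedSectionVars false

namespace QCD

variable {𝓧 : Type*} [MeasurableSpace 𝓧]

/-! ### Splitting an independent sequence at a fixed time -/

/-- The sequence that follows `ω` for the first `k` observations and then runs through `ω'`. -/
def splice (k : ℕ) (ω ω' : ℕ → 𝓧) : ℕ → 𝓧 := fun i => if i < k then ω i else ω' (i - k)

/-- The shifted sequence `ω k, ω (k + 1), …`. -/
def shift (k : ℕ) (ω : ℕ → 𝓧) : ℕ → 𝓧 := fun i => ω (k + i)

lemma splice_of_lt {k i : ℕ} (hi : i < k) (ω ω' : ℕ → 𝓧) : splice k ω ω' i = ω i := if_pos hi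

lemma splice_add (k i : ℕ) (ω ω' : ℕ → 𝓧) : splice k ω ω' (k + i) = ω' i := by
  simp [splice]

lemma splice_self (k : ℕ) (ω ω' : ℕ → 𝓧) : splice k ω ω' k = ω' 0 := splice_add k 0 ω ω'

lemma shift_splice (k : ℕ) (ω ω' : ℕ → 𝓧) : shift k (splice k ω ω') = ω' :=
  funext fun i => splice_add k i ω ω'

lemma measurable_splice (k : ℕ) :
    Measurable fun p : (ℕ → 𝓧) × (ℕ → 𝓧) => splice k p.1 p.2 := by
  refine measurable_pi_lambda _ fun i => ?_
  unfold splice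
  split_ifs <;> fun_prop

/-- Two independent sequences with the right marginals, spliced at time `k`, have independent
coordinates. All uses of independence below go through this fact. -/
lemma measurePreserving_splice (k : ℕ) (P P₁ P₂ : ℕ → Measure 𝓧)
    [∀ i, IsProbabilityMeasure (P i)] [∀ i, IsProbabilityMeasure (P₁ i)]
    [∀ i, IsProbabilityMeasure (P₂ i)]
    (h₁ : ∀ i < k, P₁ i = P i) (h₂ : ∀ i, P₂ i = P (k + i)) :
    MeasurePreserving (fun p : (ℕ → 𝓧) × (ℕ → 𝓧) => splice k p.1 p.2)
      ((Measure.infinitePi P₁).prod (Measure.infinitePi P₂)) (Measure.infinitePi P) := by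
  refine ⟨measurable_splice k, Measure.eq_infinitePi _ fun s t ht => ?_⟩
  have hpre : (fun p : (ℕ → 𝓧) × (ℕ → 𝓧) => splice k p.1 p.2) ⁻¹' Set.pi s t =
      (Set.pi (s.filter (· < k) : Finset ℕ) t) ×ˢ
        (Set.pi ((s.filter (¬ · < k)).image (· - k) : Finset ℕ) fun i => t (k + i)) := by
    ext p
    simp only [Set.mem_preimage, Set.mem_pi, Set.mem_prod, Finset.coe_filter, Finset.coe_image,
      Set.mem_ofPred_eq, Set.mem_image, Finset.mem_coe]
    constructor
    · refine fun h => ⟨fun i hi => ?_, ?_⟩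
      · simpa [splice, hi.2] using h i hi.1
      · rintro _ ⟨i, ⟨his, hik⟩, rfl⟩
        have := h i his
        simp only [splice, hik, if_false] at this
        rwa [show k + (i - k) = i by omega]
    · rintro ⟨h, h'⟩ i hi
      by_cases hik : i < k
      · simpa [splice, hik] using h i ⟨hi, hik⟩
      · have := h' (i - k) ⟨i, ⟨hi, hik⟩, rfl⟩
        simp only [splice, hik, if_false]
        rwa [show k + (i - k) = i by omega] at this
  rw [Measure.map_apply (measurable_splice k)
    (MeasurableSet.pi s.countable_toSet fun i _ => ht i), hpre, Measure.prod_prod,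
    Measure.infinitePi_pi _ fun i _ => ht i, Measure.infinitePi_pi _ fun i _ => ht (k + i),
    Finset.prod_image (by
      intro i hi j hj hij
      simp only [Finset.coe_filter, Set.mem_ofPred_eq] at hi hj
      simp only at hij
      omega),
    ← Finset.prod_filter_mul_prod_filter_not s (· < k)]
  congr 1
  · exact Finset.prod_congr rfl fun i hi => by rw [h₁ i (Finset.mem_filter.1 hi).2]
  · refine Finset.prod_congr rfl fun i hi => ?_
    have := (Finset.mem_filter.1 hi).2
    rw [h₂, show k + (i - k) = i by omega]

/-- The law of an i.i.d. sequence with marginal `P`. -/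
abbrev iidLaw (P : Measure 𝓧) : Measure (ℕ → 𝓧) := Measure.infinitePi fun _ : ℕ => P

section Iid

variable {P : Measure 𝓧} [IsProbabilityMeasure P]

lemma measurePreserving_splice_iid (k : ℕ) :
    MeasurePreserving (fun p : (ℕ → 𝓧) × (ℕ → 𝓧) => splice k p.1 p.2)
      ((iidLaw P).prod (iidLaw P)) (iidLaw P) :=
  measurePreserving_splice k _ _ _ (fun _ _ => rfl) fun _ => rfl

lemma lintegral_splice (k : ℕ) {F : (ℕ → 𝓧) → ℝ≥0∞} (hF : Measurable F) :
    ∫⁻ ω, F ω ∂iidLaw P = ∫⁻ ω, ∫⁻ ω', F (splice k ω ω') ∂iidLaw P ∂iidLaw P := by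
  rw [← (measurePreserving_splice_iid k).lintegral_comp hF]
  exact lintegral_prod _ (hF.comp (measurable_splice k)).aemeasurable

lemma lintegral_eval (k : ℕ) {g : 𝓧 → ℝ≥0∞} (hg : Measurable g) :
    ∫⁻ ω, g (ω k) ∂iidLaw P = ∫⁻ x, g x ∂P :=
  (measurePreserving_eval_infinitePi (fun _ : ℕ => P) k).lintegral_comp hg

/-- If `g (ω, x)` depends on `ω` only through its first `k` coordinates, then the next coordinate
may be integrated out. -/
lemma lintegral_next (k : ℕ) {g : (ℕ → 𝓧) × 𝓧 → ℝ≥0∞} (hg : Measurable g)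
    (hk : ∀ ω ω' x, g (splice k ω ω', x) = g (ω, x)) :
    ∫⁻ ω, g (ω, ω k) ∂iidLaw P = ∫⁻ ω, ∫⁻ x, g (ω, x) ∂P ∂iidLaw P := by
  rw [lintegral_splice k (F := fun ω => g (ω, ω k)) (by fun_prop)]
  refine lintegral_congr fun ω => ?_
  simp only [hk, splice_self]
  exact lintegral_eval 0 (g := fun x => g (ω, x)) (by fun_prop)

end Iid

/-! ### First passage times -/

lemma lt_firstTime_iff {p : ℕ → Prop} {n : ℕ} :
    (n : ℕ∞) < firstTime p ↔ ∀ m, 1 ≤ m → m ≤ n → ¬ p m := by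
  rw [← ENat.add_one_le_iff (ENat.natCast_ne_top n), firstTime]
  simp only [le_iInf_iff]
  constructor
  · intro h m h1 hmn hp
    have := h m ⟨h1, hp⟩
    norm_cast at this
    omega
  · intro h m hm
    have : ¬ m ≤ n := fun hmn => h m hm.1 hmn hm.2
    norm_cast
    omega

lemma firstTime_le {p : ℕ → Prop} {n : ℕ} (h1 : 1 ≤ n) (hp : p n) : firstTime p ≤ n :=
  iInf₂_le n ⟨h1, hp⟩

lemma firstTime_mono {p q : ℕ → Prop} (h : ∀ n, 1 ≤ n → p n → q n) :
    firstTime q ≤ firstTime p :=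
  le_iInf₂ fun n hn => firstTime_le hn.1 (h n hn.1 hn.2)

lemma toENNReal_eq_tsum (t : ℕ∞) :
    (t : ℝ≥0∞) = ∑' n : ℕ, ({n : ℕ | (n : ℕ∞) < t}.indicator 1 n : ℝ≥0∞) := by
  rw [← tsum_subtype {n : ℕ | (n : ℕ∞) < t} (1 : ℕ → ℝ≥0∞)]
  simp only [Pi.one_apply, ENNReal.tsum_one]
  congr 1
  cases t with
  | top => simp
  | coe n => simp [ENat.card_eq_coe_fintype_card]

/-- The mean of an extended natural number is the sum of its tail probabilities. -/
lemma lintegral_toENNReal {Ω : Type*} [MeasurableSpace Ω] {Q : Measure Ω} {τ : Ω → ℕ∞}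
    (hτ : ∀ n : ℕ, MeasurableSet {ω | (n : ℕ∞) < τ ω}) :
    ∫⁻ ω, (τ ω : ℝ≥0∞) ∂Q = ∑' n : ℕ, Q {ω | (n : ℕ∞) < τ ω} := by
  simp_rw [toENNReal_eq_tsum (τ _)]
  rw [lintegral_tsum fun n => Measurable.aemeasurable ?_]
  · refine tsum_congr fun n => ?_
    rw [← lintegral_indicator_one (hτ n)]
    rfl
  · exact (measurable_one.indicator (hτ n))

/-! ### Recursions driven by an independent sequence -/

/-- The recursion `w, φ w (ω 0), φ (φ w (ω 0)) (ω 1), …`. -/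
def chain (φ : ℝ → 𝓧 → ℝ) (w : ℝ) : ℕ → (ℕ → 𝓧) → ℝ
  | 0, _ => w
  | n + 1, ω => φ (chain φ w n ω) (ω n)

/-- The first time `n ≥ 1` at which the recursion started from `w` is in `B`. -/
def hitTime (φ : ℝ → 𝓧 → ℝ) (B : Set ℝ) (w : ℝ) (ω : ℕ → 𝓧) : ℕ∞ :=
  firstTime fun n => chain φ w n ω ∈ B

variable {φ : ℝ → 𝓧 → ℝ} {B : Set ℝ}

@[fun_prop]
lemma measurable_chain (hφ : Measurable (Function.uncurry φ)) (w : ℝ) (n : ℕ) :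
    Measurable (chain φ w n) := by
  induction n with
  | zero => exact measurable_const
  | succ n ih =>
    exact hφ.comp (ih.prodMk (measurable_pi_apply n))

lemma chain_congr (w : ℝ) {n : ℕ} {ω ω' : ℕ → 𝓧} (h : ∀ i < n, ω i = ω' i) :
    chain φ w n ω = chain φ w n ω' := by
  induction n with
  | zero => rfl
  | succ n ih =>
    simp only [chain]
    rw [ih fun i hi => h i (by omega), h n (by omega)]

lemma chain_splice (w : ℝ) {n k : ℕ} (hn : n ≤ k) (ω ω' : ℕ → 𝓧) :
    chain φ w n (splice k ω ω') = chain φ w n ω :=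
  chain_congr w fun _ hi => splice_of_lt (by omega) ω ω'

lemma chain_add (w : ℝ) (k n : ℕ) (ω : ℕ → 𝓧) :
    chain φ w (k + n) ω = chain φ (chain φ w k ω) n (shift k ω) := by
  induction n with
  | zero => rfl
  | succ n ih => rw [← add_assoc]; simp only [chain, ih, shift]

lemma lt_hitTime_iff {w : ℝ} {n : ℕ} {ω : ℕ → 𝓧} :
    (n : ℕ∞) < hitTime φ B w ω ↔ ∀ m, 1 ≤ m → m ≤ n → chain φ w m ω ∉ B :=
  lt_firstTime_iff

lemma lt_hitTime_succ_iff {w : ℝ} {n : ℕ} {ω : ℕ → 𝓧} :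
    ((n + 1 : ℕ) : ℕ∞) < hitTime φ B w ω ↔
      (n : ℕ∞) < hitTime φ B w ω ∧ φ (chain φ w n ω) (ω n) ∉ B := by
  simp only [lt_hitTime_iff]
  constructor
  · exact fun h => ⟨fun m h1 h2 => h m h1 (by omega), h (n + 1) (by omega) le_rfl⟩
  · rintro ⟨h, h'⟩ m h1 h2
    rcases Nat.lt_or_ge n m with hm | hm
    · obtain rfl : m = n + 1 := by omega
      exact h'
    · exact h m h1 hm

lemma measurableSet_lt_hitTime (hφ : Measurable (Function.uncurry φ)) (hB : MeasurableSet B)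
    (w : ℝ) (n : ℕ) : MeasurableSet {ω : ℕ → 𝓧 | (n : ℕ∞) < hitTime φ B w ω} := by
  simp only [lt_hitTime_iff, Set.ofPred_forall]
  refine MeasurableSet.iInter fun m => MeasurableSet.iInter fun _ => MeasurableSet.iInter fun _ => ?_
  exact (hB.preimage (measurable_chain hφ w m)).compl

lemma lt_hitTime_splice (w : ℝ) (n : ℕ) (ω ω' : ℕ → 𝓧) :
    (n : ℕ∞) < hitTime φ B w (splice n ω ω') ↔ (n : ℕ∞) < hitTime φ B w ω := by
  simp only [lt_hitTime_iff]
  refine forall₃_congr fun m _ hm => ?_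
  rw [chain_splice w hm]

/-- The state is in the good set as long as the target set has not been hit. -/
lemma chain_mem_of_lt_hitTime {G : Set ℝ} {w : ℝ} (hw : w ∈ G)
    (hG : ∀ v ∈ G, ∀ x, φ v x ∉ B → φ v x ∈ G) {n : ℕ} {ω : ℕ → 𝓧}
    (h : (n : ℕ∞) < hitTime φ B w ω) : chain φ w n ω ∈ G := by
  induction n with
  | zero => exact hw
  | succ n ih =>
    rw [lt_hitTime_succ_iff] at h
    exact hG _ (ih h.1) _ h.2

section Lyapunov

variable {P : Measure 𝓧} [IsProbabilityMeasure P]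

lemma lintegral_chain_succ (hφ : Measurable (Function.uncurry φ)) (hB : MeasurableSet B)
    {V : ℝ → ℝ≥0∞} (hV : Measurable V) (w : ℝ) (n : ℕ) :
    ∫⁻ ω in {ω | (n : ℕ∞) < hitTime φ B w ω}, V (chain φ w (n + 1) ω) ∂iidLaw P =
      ∫⁻ ω in {ω | (n : ℕ∞) < hitTime φ B w ω}, ∫⁻ x, V (φ (chain φ w n ω) x) ∂P ∂iidLaw P := by
  have hS := measurableSet_lt_hitTime hφ hB w n
  have hc := measurable_chain hφ w n
  rw [← lintegral_indicator hS, ← lintegral_indicator hS]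
  have hm : Measurable fun p : (ℕ → 𝓧) × 𝓧 =>
      {ω : ℕ → 𝓧 | (n : ℕ∞) < hitTime φ B w ω}.indicator 1 p.1 * V (φ (chain φ w n p.1) p.2) := by
    refine ((measurable_one.indicator hS).comp measurable_fst).mul (hV.comp ?_)
    exact hφ.comp ((hc.comp measurable_fst).prodMk measurable_snd)
  have := lintegral_next (P := P) n hm (fun ω ω' x => by
    simp only [chain_splice w le_rfl, Set.indicator, Set.mem_ofPred_eq, lt_hitTime_splice,
      Pi.one_apply])
  convert this using 2
  · funext ω
    by_cases h : (n : ℕ∞) < hitTime φ B w ω <;> simp [h, chain]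
  · funext ω
    by_cases h : (n : ℕ∞) < hitTime φ B w ω <;> simp [h]

/-- Upper Lyapunov bound: if a nonnegative function `V` of the state decreases by at least `1`
on average in each step before `B` is hit, then the mean hitting time is at most `V w`. -/
lemma lintegral_hitTime_le (hφ : Measurable (Function.uncurry φ)) (hB : MeasurableSet B)
    {V : ℝ → ℝ≥0∞} (hV : Measurable V) {G : Set ℝ} {w : ℝ} (hw : w ∈ G)
    (hG : ∀ v ∈ G, ∀ x, φ v x ∉ B → φ v x ∈ G)
    (hstep : ∀ v ∈ G, 1 + ∫⁻ x, V (φ v x) ∂P ≤ V v) :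
    ∫⁻ ω, (hitTime φ B w ω : ℝ≥0∞) ∂iidLaw P ≤ V w := by
  set T : ℕ → Set (ℕ → 𝓧) := fun n => {ω | (n : ℕ∞) < hitTime φ B w ω} with hT
  have hTm : ∀ n, MeasurableSet (T n) := measurableSet_lt_hitTime hφ hB w
  rw [lintegral_toENNReal hTm]
  refine ENNReal.tsum_le_of_sum_range_le fun N => ?_
  suffices h : ∑ n ∈ Finset.range N, iidLaw P (T n) +
      ∫⁻ ω in T N, V (chain φ w N ω) ∂iidLaw P ≤ V w from le_self_add.trans h
  induction N with
  | zero =>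
    simp only [Finset.range_zero, Finset.sum_empty, zero_add, chain]
    exact (setLIntegral_const _ _).trans_le (mul_le_of_le_one_right' prob_le_one)
  | succ N ih =>
    refine le_trans ?_ ih
    rw [Finset.sum_range_succ, add_assoc]
    gcongr
    have hsub : T (N + 1) ⊆ T N := fun ω h => (lt_hitTime_succ_iff.1 h).1
    calc iidLaw P (T N) + ∫⁻ ω in T (N + 1), V (chain φ w (N + 1) ω) ∂iidLaw P
        ≤ iidLaw P (T N) + ∫⁻ ω in T N, V (chain φ w (N + 1) ω) ∂iidLaw P := by
          gcongr
      _ = ∫⁻ ω in T N, (1 + ∫⁻ x, V (φ (chain φ w N ω) x) ∂P) ∂iidLaw P := by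
          rw [lintegral_chain_succ hφ hB hV, lintegral_add_left measurable_const]
          simp [hT]
      _ ≤ ∫⁻ ω in T N, V (chain φ w N ω) ∂iidLaw P :=
          setLIntegral_mono (hV.comp (measurable_chain hφ w N)) fun ω hω =>
            hstep _ (chain_mem_of_lt_hitTime hw hG hω)

/-- Lower Lyapunov bound: if a nonnegative function `U` of the state increases by at most `c` on
average in each step and is at least `K` on `B`, then the mean hitting time is at least
`(K - U w) / c`. -/
lemma le_lintegral_hitTime (hφ : Measurable (Function.uncurry φ)) (hB : MeasurableSet B)
    {U : ℝ → ℝ≥0∞} (hU : Measurable U) {G : Set ℝ} {w : ℝ} (hw : w ∈ G)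
    (hG : ∀ v ∈ G, ∀ x, φ v x ∈ G) {c K : ℝ≥0∞} (hc : c ≠ 0)
    (hstep : ∀ v ∈ G, ∫⁻ x, U (φ v x) ∂P ≤ U v + c) (hK : ∀ v ∈ G, v ∈ B → K ≤ U v) :
    K ≤ U w + c * ∫⁻ ω, (hitTime φ B w ω : ℝ≥0∞) ∂iidLaw P := by
  set T : ℕ → Set (ℕ → 𝓧) := fun n => {ω | (n : ℕ∞) < hitTime φ B w ω} with hT
  have hTm : ∀ n, MeasurableSet (T n) := measurableSet_lt_hitTime hφ hB w
  rw [lintegral_toENNReal hTm]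
  by_cases htop : ∑' n, iidLaw P (T n) = ∞
  · simp only [hT] at htop
    simp [htop, ENNReal.mul_top hc]
  have hG' : ∀ v ∈ G, ∀ x, φ v x ∉ B → φ v x ∈ G := fun v hv x _ => hG v hv x
  have hsub : ∀ n, T (n + 1) ⊆ T n := fun n ω h => (lt_hitTime_succ_iff.1 h).1
  have hT0 : T 0 = Set.univ := by
    ext ω; simp only [hT, Set.mem_ofPred_eq, Set.mem_univ, iff_true, lt_hitTime_iff]
    intro m h1 h2; omega
  have main : ∀ N, ∫⁻ ω in T N, U (chain φ w N ω) ∂iidLaw P + K * iidLaw P (T N)ᶜ ≤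
      U w + c * ∑ n ∈ Finset.range N, iidLaw P (T n) := by
    intro N
    induction N with
    | zero => simp [hT0, chain]
    | succ N ih =>
      have hdec : (T (N + 1))ᶜ = (T N)ᶜ ∪ (T N \ T (N + 1)) := by
        ext ω
        simp only [Set.mem_compl_iff, Set.mem_union, Set.mem_sdiff]
        have := @hsub N ω
        tauto
      have hK' : K * iidLaw P (T N \ T (N + 1)) ≤
          ∫⁻ ω in T N \ T (N + 1), U (chain φ w (N + 1) ω) ∂iidLaw P := by
        rw [← setLIntegral_const]
        refine setLIntegral_mono (hU.comp (measurable_chain hφ w _)) fun ω hω => ?_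
        have hmem := chain_mem_of_lt_hitTime hw hG' hω.1
        refine hK _ (hG _ hmem _) ?_
        by_contra hn
        exact hω.2 (lt_hitTime_succ_iff.2 ⟨hω.1, hn⟩)
      calc ∫⁻ ω in T (N + 1), U (chain φ w (N + 1) ω) ∂iidLaw P + K * iidLaw P (T (N + 1))ᶜ
          ≤ ∫⁻ ω in T (N + 1), U (chain φ w (N + 1) ω) ∂iidLaw P +
              (K * iidLaw P (T N)ᶜ + K * iidLaw P (T N \ T (N + 1))) := by
            rw [hdec, ← mul_add]
            gcongr
            exact measure_union_le _ _
        _ ≤ (∫⁻ ω in T N \ T (N + 1), U (chain φ w (N + 1) ω) ∂iidLaw P +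
              ∫⁻ ω in T (N + 1), U (chain φ w (N + 1) ω) ∂iidLaw P) + K * iidLaw P (T N)ᶜ := by
            rw [add_comm (K * iidLaw P (T N)ᶜ), ← add_assoc, add_comm (∫⁻ ω in T (N + 1), _ ∂_)]
            gcongr
        _ = ∫⁻ ω in T N, ∫⁻ x, U (φ (chain φ w N ω) x) ∂P ∂iidLaw P + K * iidLaw P (T N)ᶜ := by
            rw [← lintegral_chain_succ hφ hB hU, ← lintegral_union (hTm (N + 1))
              Set.disjoint_sdiff_left, Set.sdiff_union_of_subset (hsub N)]
        _ ≤ ∫⁻ ω in T N, (U (chain φ w N ω) + c) ∂iidLaw P + K * iidLaw P (T N)ᶜ := by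
            gcongr ?_ + _
            exact setLIntegral_mono ((hU.comp (measurable_chain hφ w N)).add_const c)
              fun ω hω => hstep _ (chain_mem_of_lt_hitTime hw hG' hω)
        _ = (∫⁻ ω in T N, U (chain φ w N ω) ∂iidLaw P + K * iidLaw P (T N)ᶜ) +
              c * iidLaw P (T N) := by
            rw [lintegral_add_right _ measurable_const, setLIntegral_const]
            ring
        _ ≤ _ := by
            rw [Finset.sum_range_succ, mul_add, ← add_assoc]
            gcongr
  have hlim : Tendsto (fun N => iidLaw P (T N)) atTop (𝓝 0) :=
    ENNReal.tendsto_atTop_zero_of_tsum_ne_top htop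
  have hlim' : Tendsto (fun N => K * iidLaw P (T N)ᶜ) atTop (𝓝 (K * 1)) := by
    have : Tendsto (fun N => iidLaw P (T N)ᶜ) atTop (𝓝 1) := by
      simp_rw [prob_compl_eq_one_sub (hTm _)]
      simpa using ENNReal.Tendsto.sub (tendsto_const_nhds (x := (1 : ℝ≥0∞))) hlim (by simp)
    exact ENNReal.Tendsto.const_mul this (by simp)
  rw [mul_one] at hlim'
  refine le_of_tendsto' hlim' fun N => ?_
  refine le_add_self.trans ((main N).trans ?_)
  gcongr
  exact ENNReal.sum_le_tsum _

end Lyapunov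

/-! ### The log-likelihood ratio -/

section Density

variable {ν : Measure 𝓧} {f0 f1 : 𝓧 → ℝ}

lemma IsPdf.isProbabilityMeasure_law {f : 𝓧 → ℝ} (hf : IsPdf ν f) :
    IsProbabilityMeasure (law ν f) :=
  ⟨by rw [law, withDensity_apply _ .univ, Measure.restrict_univ, hf.lintegral_eq_one]⟩

lemma IsPdf.measurable_logLR (hf0 : IsPdf ν f0) (hf1 : IsPdf ν f1) : Measurable (logLR f0 f1) :=
  Real.measurable_log.comp (hf1.measurable.div hf0.measurable)

lemma logLR_swap (x : 𝓧) : logLR f1 f0 x = -logLR f0 f1 x := by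
  rw [logLR, logLR, ← Real.log_inv, inv_div]

lemma IsPdf.ae_pos {f : 𝓧 → ℝ} (hf : IsPdf ν f) : ∀ᵐ x ∂law ν f, 0 < f x := by
  rw [law, ae_withDensity_iff hf.measurable.ennreal_ofReal]
  exact ae_of_all _ fun x hx => by simpa using hx

lemma law_eq_withDensity (hf0 : IsPdf ν f0) (hf1 : IsPdf ν f1)
    (hac : law ν f1 ≪ law ν f0) :
    law ν f1 = (law ν f0).withDensity fun x => ENNReal.ofReal (f1 x / f0 x) := by
  have hf0' := hf0.measurable
  have hf1' := hf1.measurable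
  have h := hac.ae_le hf0.ae_pos
  change ∀ᵐ x ∂law ν f1, 0 < f0 x at h
  rw [law, ae_withDensity_iff (by fun_prop)] at h
  rw [law, law, ← withDensity_mul _ (by fun_prop) (by fun_prop)]
  refine withDensity_congr_ae ?_
  filter_upwards [h] with x hx
  rw [Pi.mul_apply, ← ENNReal.ofReal_mul (hf0.nonneg x)]
  by_cases h1 : ENNReal.ofReal (f1 x) = 0
  · have : f1 x = 0 := le_antisymm (by simpa using h1) (hf1.nonneg x)
    simp [this]
  · rw [mul_div_cancel₀ _ (hx h1).ne']

variable [SigmaFinite ν]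

lemma llr_ae_eq (hf0 : IsPdf ν f0) (hf1 : IsPdf ν f1) (hac : law ν f1 ≪ law ν f0) :
    llr (law ν f1) (law ν f0) =ᵐ[law ν f1] logLR f0 f1 := by
  have := hf0.isProbabilityMeasure_law
  have h : (law ν f1).rnDeriv (law ν f0) =ᵐ[law ν f0] fun x => ENNReal.ofReal (f1 x / f0 x) := by
    conv_lhs => rw [law_eq_withDensity hf0 hf1 hac]
    exact Measure.rnDeriv_withDensity _ (hf1.measurable.div hf0.measurable).ennreal_ofReal
  filter_upwards [hac.ae_le h] with x hx
  rw [llr, hx, ENNReal.toReal_ofReal (div_nonneg (hf1.nonneg x) (hf0.nonneg x)), logLR]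

lemma integrable_logLR (hf0 : IsPdf ν f0) (hf1 : IsPdf ν f1)
    (h : InformationTheory.klDiv (law ν f1) (law ν f0) < ∞) :
    Integrable (logLR f0 f1) (law ν f1) := by
  obtain ⟨hac, hint⟩ := InformationTheory.klDiv_ne_top_iff.1 h.ne
  exact hint.congr (llr_ae_eq hf0 hf1 hac)

lemma integral_logLR (hf0 : IsPdf ν f0) (hf1 : IsPdf ν f1)
    (h : InformationTheory.klDiv (law ν f1) (law ν f0) < ∞) :
    ∫ x, logLR f0 f1 x ∂law ν f1 = (InformationTheory.klDiv (law ν f1) (law ν f0)).toReal := by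
  have := hf0.isProbabilityMeasure_law
  have := hf1.isProbabilityMeasure_law
  obtain ⟨hac, -⟩ := InformationTheory.klDiv_ne_top_iff.1 h.ne
  rw [InformationTheory.toReal_klDiv_of_measure_eq hac (by simp),
    integral_congr_ae (llr_ae_eq hf0 hf1 hac)]

/-- The likelihood ratio has mean at most `1` before the change. -/
lemma lintegral_exp_logLR_le (hf0 : IsPdf ν f0) (hf1 : IsPdf ν f1)
    (h10 : law ν f1 ≪ law ν f0) (h01 : law ν f0 ≪ law ν f1) :
    ∫⁻ x, ENNReal.ofReal (Real.exp (logLR f0 f1 x)) ∂law ν f0 ≤ 1 := by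
  have := hf1.isProbabilityMeasure_law
  have h1 : ∀ᵐ x ∂law ν f0, 0 < f1 x := h01.ae_le hf1.ae_pos
  have : ∫⁻ x, ENNReal.ofReal (Real.exp (logLR f0 f1 x)) ∂law ν f0 = law ν f1 Set.univ := by
    conv_rhs => rw [law_eq_withDensity hf0 hf1 h10, withDensity_apply _ .univ,
      Measure.restrict_univ]
    refine lintegral_congr_ae ?_
    filter_upwards [h1, hf0.ae_pos] with x hx1 hx0
    rw [logLR, Real.exp_log (div_pos hx1 hx0)]
  rw [this, measure_univ]

end Density

/-- If `E[g]` is positive, then `E[min (1, e^{-g})]` is strictly less than `1`. -/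
lemma integral_min_one_exp_lt_one {P : Measure 𝓧} [IsProbabilityMeasure P] {g : 𝓧 → ℝ}
    (hg : Integrable g P) (hpos : 0 < ∫ x, g x ∂P) :
    ∫ x, min 1 (Real.exp (-g x)) ∂P < 1 := by
  have hint : Integrable (fun x => min 1 (Real.exp (-g x))) P := by
    refine Integrable.mono' (integrable_const (1 : ℝ)) ?_ (ae_of_all _ fun x => ?_)
    · exact (continuous_const.min (Real.continuous_exp.comp continuous_neg)).comp_aestronglyMeasurable
        hg.aestronglyMeasurable
    · rw [Real.norm_of_nonneg (le_min zero_le_one (Real.exp_pos _).le)]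
      exact min_le_left _ _
  by_contra! hcon
  have h0 : ∫ x, (1 - min 1 (Real.exp (-g x))) ∂P = 0 := by
    refine le_antisymm ?_ (integral_nonneg fun x => by simp)
    rw [integral_sub (integrable_const _) hint]
    simpa using hcon
  replace h0 := (integral_eq_zero_iff_of_nonneg (fun x => by simp)
    ((integrable_const (1 : ℝ)).sub hint)).1 h0
  refine hpos.not_ge (integral_nonpos_of_ae ?_)
  filter_upwards [h0] with x hx
  have hx : 1 - min 1 (Real.exp (-g x)) = 0 := hx
  have : 1 ≤ Real.exp (-g x) := (sub_eq_zero.1 hx).le.trans (min_le_right _ _)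
  simpa using Real.one_le_exp_iff.1 this

/-- Truncating an integrable function from below at a low level hardly changes its mean. -/
lemma tendsto_integral_max_neg {P : Measure 𝓧} {g : 𝓧 → ℝ} (hg : Integrable g P) :
    Tendsto (fun M : ℝ => ∫ x, max (g x) (-M) ∂P) atTop (𝓝 (∫ x, g x ∂P)) := by
  refine tendsto_integral_filter_of_dominated_convergence (fun x => |g x|) ?_ ?_ hg.abs ?_
  · exact Eventually.of_forall fun M => (continuous_id.max
      continuous_const).comp_aestronglyMeasurable hg.aestronglyMeasurable
  · filter_upwards [eventually_ge_atTop 0] with M hM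
    refine ae_of_all _ fun x => ?_
    rw [Real.norm_eq_abs, abs_le]
    constructor
    · exact (neg_abs_le _).trans (le_max_left _ _)
    · exact max_le (le_abs_self _) (by linarith [abs_nonneg (g x)])
  · refine ae_of_all _ fun x => ?_
    refine tendsto_const_nhds.congr' ?_
    filter_upwards [eventually_ge_atTop (-g x)] with M hM
    rw [max_eq_left (by linarith)]

lemma tendsto_integral_min {P : Measure 𝓧} {g : 𝓧 → ℝ} (hg : Integrable g P) :
    Tendsto (fun M : ℝ => ∫ x, min (g x) M ∂P) atTop (𝓝 (∫ x, g x ∂P)) := by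
  have := (tendsto_integral_max_neg hg.neg).neg
  simp only [← integral_neg, Pi.neg_apply, neg_neg] at this
  refine this.congr fun M => integral_congr_ae (ae_of_all _ fun x => ?_)
  simp [max_neg_neg]

/-! ### The laws of the observations -/

section Laws

variable {ν : Measure 𝓧} {f0 f1 : 𝓧 → ℝ}

lemma noChangeLaw_eq : noChangeLaw ν f0 f1 = iidLaw (law ν f0) := by
  unfold noChangeLaw changeLaw iidLaw
  have : ∀ i : ℕ, ((i + 1 : ℕ) : ℕ∞) < ⊤ := fun i => ENat.natCast_lt_top _
  simp only [this, if_true]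

lemma changeLaw_one_eq : changeLaw ν f0 f1 1 = iidLaw (law ν f1) := by
  unfold changeLaw iidLaw
  have : ∀ i : ℕ, ¬ ((i + 1 : ℕ) : ℕ∞) < 1 := fun i => by norm_cast; omega
  simp only [this, if_false]

lemma isProbabilityMeasure_changeLaw (hf0 : IsPdf ν f0) (hf1 : IsPdf ν f1) (γ : ℕ∞) :
    IsProbabilityMeasure (changeLaw ν f0 f1 γ) := by
  have := hf0.isProbabilityMeasure_law
  have := hf1.isProbabilityMeasure_law
  have : ∀ i : ℕ, IsProbabilityMeasure
      (if ((i + 1 : ℕ) : ℕ∞) < γ then law ν f0 else law ν f1) := fun i => by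
    split_ifs <;> infer_instance
  unfold changeLaw
  infer_instance

/-- A sequence with change point `k + 1` consists of `k` pre-change observations, followed by an
independent sequence of post-change observations. -/
lemma measurePreserving_splice_changeLaw (hf0 : IsPdf ν f0) (hf1 : IsPdf ν f1) (k : ℕ) :
    MeasurePreserving (fun p : (ℕ → 𝓧) × (ℕ → 𝓧) => splice k p.1 p.2)
      ((iidLaw (law ν f0)).prod (iidLaw (law ν f1))) (changeLaw ν f0 f1 ((k + 1 : ℕ) : ℕ∞)) := by
  have := hf0.isProbabilityMeasure_law
  have := hf1.isProbabilityMeasure_law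
  have : ∀ i : ℕ, IsProbabilityMeasure
      (if ((i + 1 : ℕ) : ℕ∞) < ((k + 1 : ℕ) : ℕ∞) then law ν f0 else law ν f1) := fun i => by
    split_ifs <;> infer_instance
  refine measurePreserving_splice k _ _ _ (fun i hi => ?_) (fun i => ?_)
  · rw [if_pos (by exact_mod_cast Nat.succ_lt_succ hi)]
  · rw [if_neg (by norm_cast; omega)]

lemma lintegral_changeLaw (hf0 : IsPdf ν f0) (hf1 : IsPdf ν f1) (k : ℕ)
    {F : (ℕ → 𝓧) → ℝ≥0∞} (hF : Measurable F) :
    ∫⁻ ω, F ω ∂changeLaw ν f0 f1 ((k + 1 : ℕ) : ℕ∞) =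
      ∫⁻ ω, ∫⁻ ω', F (splice k ω ω') ∂iidLaw (law ν f1) ∂iidLaw (law ν f0) := by
  have := hf0.isProbabilityMeasure_law
  have := hf1.isProbabilityMeasure_law
  rw [← (measurePreserving_splice_changeLaw hf0 hf1 k).lintegral_comp hF]
  exact lintegral_prod _ (hF.comp (measurable_splice k)).aemeasurable

end Laws

/-! ### The test statistics as recursions -/

section Statistics

variable {f0 f1 : 𝓧 → ℝ} {μ : ℝ} {h : ℝ≥0∞}

/-- One step of the DE-CuSum recursion. -/
def decusumStep (f0 f1 : 𝓧 → ℝ) (μ : ℝ) (h : ℝ≥0∞) (w : ℝ) (x : 𝓧) : ℝ :=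
  if 0 ≤ w then trunc h (w + logLR f0 f1 x) else min (w + μ) 0

lemma decusum_eq_chain (n : ℕ) (ω : ℕ → 𝓧) :
    decusum f0 f1 μ h n ω = chain (decusumStep f0 f1 μ h) 0 n ω := by
  induction n with
  | zero => rfl
  | succ n ih => simp only [decusum, chain, ih, decusumStep]

lemma decusumTime_eq_hitTime (A : ℝ) (ω : ℕ → 𝓧) :
    decusumTime f0 f1 μ h A ω = hitTime (decusumStep f0 f1 μ h) (Set.Ici A) 0 ω := by
  simp only [decusumTime, hitTime, decusum_eq_chain, Set.mem_Ici]

lemma decusumControl_succ (n : ℕ) (ω : ℕ → 𝓧) :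
    decusumControl f0 f1 μ h (n + 1) ω = if 0 ≤ decusum f0 f1 μ h n ω then 1 else 0 := rfl

lemma measurable_trunc : Measurable (trunc h) := by
  unfold trunc
  split_ifs <;> fun_prop

lemma trunc_coe (h : ℝ≥0) (x : ℝ) : trunc h x = max x (-h) := by simp [trunc]

lemma trunc_of_nonneg {x : ℝ} (hx : 0 ≤ x) : trunc h x = x := by
  unfold trunc
  split_ifs
  · rfl
  · exact max_eq_left (by linarith [h.toReal_nonneg])

lemma trunc_nonpos {x : ℝ} (hx : x ≤ 0) : trunc h x ≤ 0 := by
  unfold trunc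
  split_ifs
  · exact hx
  · exact max_le hx (by simp)

lemma measurable_decusumStep (hl : Measurable (logLR f0 f1)) :
    Measurable (Function.uncurry (decusumStep f0 f1 μ h)) := by
  unfold decusumStep Function.uncurry
  refine Measurable.ite (measurableSet_le measurable_const measurable_fst) ?_ (by fun_prop)
  exact measurable_trunc.comp (by fun_prop)

lemma measurable_decusum (hl : Measurable (logLR f0 f1)) (n : ℕ) :
    Measurable (decusum f0 f1 μ h n) := by
  have : decusum f0 f1 μ h n = chain (decusumStep f0 f1 μ h) 0 n :=
    funext fun ω => decusum_eq_chain n ω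
  rw [this]
  exact measurable_chain (measurable_decusumStep hl) 0 n

lemma measurableSet_decusum_nonneg (hl : Measurable (logLR f0 f1)) (n : ℕ) :
    MeasurableSet {ω | 0 ≤ decusum f0 f1 μ h n ω} :=
  measurableSet_le measurable_const (measurable_decusum hl n)

lemma decusum_splice {n k : ℕ} (hn : n ≤ k) (ω ω' : ℕ → 𝓧) :
    decusum f0 f1 μ h n (splice k ω ω') = decusum f0 f1 μ h n ω := by
  simp only [decusum_eq_chain, chain_splice 0 hn]

lemma measurable_decusumControl (hl : Measurable (logLR f0 f1)) (n : ℕ) :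
    Measurable (decusumControl f0 f1 μ h n) := by
  cases n with
  | zero => exact measurable_const
  | succ n =>
    exact Measurable.ite (measurableSet_decusum_nonneg hl n) measurable_const measurable_const

/-- Skipping observations and truncating can only delay the DE-CuSum test. -/
lemma decusum_le_cusum (n : ℕ) (ω : ℕ → 𝓧) : decusum f0 f1 μ h n ω ≤ cusum f0 f1 n ω := by
  induction n with
  | zero => exact le_rfl
  | succ n ih =>
    simp only [decusum, cusum]
    split_ifs with hW
    · rcases le_total 0 (decusum f0 f1 μ h n ω + logLR f0 f1 (ω n)) with hx | hx
      · rw [trunc_of_nonneg hx]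
        exact le_max_of_le_left (by linarith)
      · exact (trunc_nonpos hx).trans (le_max_right _ _)
    · exact (min_le_right _ _).trans (le_max_right _ _)

lemma cusumTime_le_decusumTime (A : ℝ) (ω : ℕ → 𝓧) :
    cusumTime f0 f1 A ω ≤ decusumTime f0 f1 μ h A ω :=
  firstTime_mono fun n _ hn => hn.trans (decusum_le_cusum n ω)

lemma cusum_nonneg (n : ℕ) (ω : ℕ → 𝓧) : 0 ≤ cusum f0 f1 n ω := by
  cases n with
  | zero => exact le_rfl
  | succ n => exact le_max_right _ _

/-- The CuSum test is the DE-CuSum test with truncation level `0`. -/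
lemma cusum_eq_decusum_zero (n : ℕ) (ω : ℕ → 𝓧) :
    cusum f0 f1 n ω = decusum f0 f1 μ (0 : ℝ≥0) n ω := by
  induction n with
  | zero => rfl
  | succ n ih =>
    simp only [decusum, ← ih, if_pos (cusum_nonneg n ω), trunc_coe, cusum, NNReal.coe_zero, neg_zero]

/-- One step of the CuSum recursion. -/
def cusumStep (f0 f1 : 𝓧 → ℝ) (w : ℝ) (x : 𝓧) : ℝ := max (w + logLR f0 f1 x) 0

lemma cusumTime_eq_hitTime (A : ℝ) (ω : ℕ → 𝓧) :
    cusumTime f0 f1 A ω = hitTime (cusumStep f0 f1) (Set.Ici A) 0 ω := by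
  have : ∀ n, cusum f0 f1 n ω = chain (cusumStep f0 f1) 0 n ω := fun n => by
    induction n with
    | zero => rfl
    | succ n ih => simp only [cusum, chain, ih, cusumStep]
  simp only [cusumTime, hitTime, this, Set.mem_Ici]

lemma measurable_cusumStep (hl : Measurable (logLR f0 f1)) :
    Measurable (Function.uncurry (cusumStep f0 f1)) := by
  unfold cusumStep Function.uncurry
  fun_prop

lemma walk_succ (n : ℕ) (ω : ℕ → 𝓧) :
    walk f0 f1 (n + 1) ω = walk f0 f1 n ω + logLR f0 f1 (ω n) := Finset.sum_range_succ _ _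

lemma ladderTime_eq_hitTime (ω : ℕ → 𝓧) : ladderTime f0 f1 ω =
    hitTime (fun w x => w + logLR f0 f1 x) (Set.Iio 0) 0 ω := by
  have : ∀ n, walk f0 f1 n ω = chain (fun w x => w + logLR f0 f1 x) 0 n ω := fun n => by
    induction n with
    | zero => simp [walk, chain]
    | succ n ih => simp only [walk_succ, chain, ih]
  simp only [ladderTime, hitTime, this, Set.mem_Iio]

lemma measurable_add_logLR (hl : Measurable (logLR f0 f1)) :
    Measurable (Function.uncurry fun w x => w + logLR f0 f1 x) := by
  unfold Function.uncurry
  fun_prop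

end Statistics

/-! ### Mean hitting times from Lyapunov functions -/

section Hitting

variable {P : Measure 𝓧} [IsProbabilityMeasure P] {f0 f1 : 𝓧 → ℝ}

/-- Lorden's bound on the mean time to false alarm. -/
lemma exp_le_lintegral_cusumTime (hl : Measurable (logLR f0 f1))
    (hexp : ∫⁻ x, ENNReal.ofReal (Real.exp (logLR f0 f1 x)) ∂P ≤ 1) {A : ℝ} (hA : 0 < A) :
    ENNReal.ofReal (Real.exp A) ≤ ∫⁻ ω, (cusumTime f0 f1 A ω : ℝ≥0∞) ∂iidLaw P := by
  simp_rw [cusumTime_eq_hitTime]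
  -- The Lyapunov function `e^w` has to be cut off at `w = 0`: the reflection of the CuSum
  -- statistic at `0` would otherwise add `1` to its drift.
  let U : ℝ → ℝ≥0∞ := fun w => if 0 < w then ENNReal.ofReal (Real.exp w) else 0
  have hU : Measurable U := by
    refine Measurable.ite (measurableSet_lt measurable_const measurable_id) ?_ measurable_const
    fun_prop
  have := le_lintegral_hitTime (P := P) (measurable_cusumStep hl) (measurableSet_Ici (a := A)) hU
    (G := Set.Ici 0) (w := 0) (c := 1) (K := ENNReal.ofReal (Real.exp A)) (by simp)
    (fun v _ x => Set.mem_Ici.2 (le_max_right _ _)) one_ne_zero ?_ ?_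
  · simpa [U] using this
  · intro v hv
    calc ∫⁻ x, U (cusumStep f0 f1 v x) ∂P
        ≤ ∫⁻ x, ENNReal.ofReal (Real.exp v) * ENNReal.ofReal (Real.exp (logLR f0 f1 x)) ∂P := by
          refine lintegral_mono fun x => ?_
          simp only [U, cusumStep]
          split_ifs with hx
          · have : 0 ≤ v + logLR f0 f1 x := by
              by_contra! hneg
              simp [hneg.le] at hx
            rw [max_eq_left this, Real.exp_add, ENNReal.ofReal_mul (Real.exp_pos _).le]
          · simp
      _ ≤ ENNReal.ofReal (Real.exp v) := by
          rw [lintegral_const_mul _ (by fun_prop)]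
          exact mul_le_of_le_one_right' hexp
      _ ≤ U v + 1 := by
          rcases (Set.mem_Ici.1 hv).eq_or_lt with rfl | hv
          · simp [U]
          · simp [U, hv]
  · intro v _ hv
    have hv' : A ≤ v := hv
    simp only [U, if_pos (hA.trans_le hv')]
    gcongr

/-- A random walk with negative drift has a ladder epoch of finite mean. -/
lemma lintegral_ladderTime_lt_top (hl : Measurable (logLR f0 f1))
    (hint : Integrable (logLR f0 f1) P) (hneg : ∫ x, logLR f0 f1 x ∂P < 0) :
    ∫⁻ ω, (ladderTime f0 f1 ω : ℝ≥0∞) ∂iidLaw P < ∞ := by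
  obtain ⟨M, hM, hMpos⟩ := (((tendsto_integral_max_neg hint).eventually_lt_const hneg).and
    (eventually_ge_atTop 0)).exists
  set δ := -∫ x, max (logLR f0 f1 x) (-M) ∂P with hδ
  have hδ0 : 0 < δ := by linarith
  have hintM : Integrable (fun x => max (logLR f0 f1 x) (-M)) P := hint.sup (integrable_const _)
  simp_rw [ladderTime_eq_hitTime]
  refine (lintegral_hitTime_le (P := P) (V := fun w => ENNReal.ofReal ((w + M) / δ))
    (G := Set.Ici 0) (measurable_add_logLR hl) measurableSet_Iio (by fun_prop)
    (by simp) (fun v _ x hx => by simpa using hx) ?_).trans_lt ENNReal.ofReal_lt_top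
  intro v hv
  have hv : 0 ≤ v := hv
  have hi' : Integrable (fun x => v + max (logLR f0 f1 x) (-M)) P :=
    (integrable_const v).add hintM
  have hi : Integrable (fun x => (v + max (logLR f0 f1 x) (-M) + M) / δ) P :=
    (hi'.add (integrable_const M)).div_const δ
  have hval : ∫ x, (v + max (logLR f0 f1 x) (-M) + M) / δ ∂P = (v + M) / δ - 1 := by
    rw [integral_div, integral_add hi' (integrable_const _),
      integral_add (integrable_const _) hintM]
    simp only [integral_const, probReal_univ, one_smul]
    rw [show ∫ x, max (logLR f0 f1 x) (-M) ∂P = -δ by simp [hδ]]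
    field_simp
    ring
  have hnn : 0 ≤ (v + M) / δ - 1 := by
    rw [← hval]
    refine integral_nonneg fun x => div_nonneg ?_ hδ0.le
    linarith [le_max_right (logLR f0 f1 x) (-M)]
  calc 1 + ∫⁻ x, ENNReal.ofReal ((v + logLR f0 f1 x + M) / δ) ∂P
      ≤ 1 + ∫⁻ x, ENNReal.ofReal ((v + max (logLR f0 f1 x) (-M) + M) / δ) ∂P := by
        gcongr with x
        exact le_max_left _ _
    _ = ENNReal.ofReal 1 + ENNReal.ofReal ((v + M) / δ - 1) := by
        rw [← ofReal_integral_eq_lintegral_ofReal hi (ae_of_all _ fun x => div_nonneg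
          (by linarith [le_max_right (logLR f0 f1 x) (-M)]) hδ0.le), hval, ENNReal.ofReal_one]
    _ = ENNReal.ofReal ((v + M) / δ) := by
        rw [← ENNReal.ofReal_add zero_le_one hnn]
        congr 1
        ring

/-- After the change, CuSum needs at least `(A - 1) / D` observations on average, `D` being the
mean of the log-likelihood ratio. -/
lemma le_lintegral_cusumTime (hl : Measurable (logLR f0 f1)) (hint : Integrable (logLR f0 f1) P)
    (hpos : 0 < ∫ x, logLR f0 f1 x ∂P)
    (hexp : ∫⁻ x, ENNReal.ofReal (Real.exp (-logLR f0 f1 x)) ∂P ≤ 1) (A : ℝ) :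
    ENNReal.ofReal A ≤
      1 + ENNReal.ofReal (∫ x, logLR f0 f1 x ∂P) *
        ∫⁻ ω, (cusumTime f0 f1 A ω : ℝ≥0∞) ∂iidLaw P := by
  simp_rw [cusumTime_eq_hitTime]
  have hexpint : Integrable (fun x => Real.exp (-logLR f0 f1 x)) P := by
    refine ⟨by fun_prop, ?_⟩
    rw [hasFiniteIntegral_iff_ofReal (ae_of_all _ fun x => (Real.exp_pos _).le)]
    exact hexp.trans_lt ENNReal.one_lt_top
  have hexp1 : ∫ x, Real.exp (-logLR f0 f1 x) ∂P ≤ 1 := by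
    rw [← ENNReal.ofReal_le_one,
      ofReal_integral_eq_lintegral_ofReal hexpint (ae_of_all _ fun x => (Real.exp_pos _).le)]
    exact hexp
  -- The correction `e^{-w}` absorbs the reflection at `0`, as `x⁻ + min (1, e^{-x}) ≤ e^{-x}`.
  have := le_lintegral_hitTime (P := P) (measurable_cusumStep hl) (measurableSet_Ici (a := A))
    (U := fun w => ENNReal.ofReal (w + Real.exp (-w))) (by fun_prop)
    (G := Set.Ici 0) (w := 0) (c := ENNReal.ofReal (∫ x, logLR f0 f1 x ∂P))
    (K := ENNReal.ofReal A) (by simp) (fun v _ x => Set.mem_Ici.2 (le_max_right _ _))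
    (by simpa using hpos) ?_ ?_
  · simpa using this
  · intro v hv
    have hv : 0 ≤ v := hv
    have hi' : Integrable (fun x => v + logLR f0 f1 x) P := (integrable_const v).add hint
    have hi : Integrable (fun x => v + logLR f0 f1 x +
        Real.exp (-v) * Real.exp (-logLR f0 f1 x)) P := hi'.add (hexpint.const_mul _)
    have hpt : ∀ x, max (v + logLR f0 f1 x) 0 + Real.exp (-max (v + logLR f0 f1 x) 0) ≤
        v + logLR f0 f1 x + Real.exp (-v) * Real.exp (-logLR f0 f1 x) := fun x => by
      rw [← Real.exp_add, ← neg_add]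
      rcases le_total 0 (v + logLR f0 f1 x) with hx | hx
      · rw [max_eq_left hx]
      · rw [max_eq_right hx]
        have := Real.add_one_le_exp (-(v + logLR f0 f1 x))
        simp only [neg_zero, Real.exp_zero]
        linarith
    have hpt0 : ∀ x, 0 ≤ v + logLR f0 f1 x + Real.exp (-v) * Real.exp (-logLR f0 f1 x) :=
      fun x => le_trans (add_nonneg (le_max_right _ _) (Real.exp_pos _).le) (hpt x)
    calc ∫⁻ x, ENNReal.ofReal (cusumStep f0 f1 v x + Real.exp (-cusumStep f0 f1 v x)) ∂P
        ≤ ∫⁻ x, ENNReal.ofReal (v + logLR f0 f1 x +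
            Real.exp (-v) * Real.exp (-logLR f0 f1 x)) ∂P :=
          lintegral_mono fun x => ENNReal.ofReal_le_ofReal (hpt x)
      _ = ENNReal.ofReal (v + ∫ x, logLR f0 f1 x ∂P +
            Real.exp (-v) * ∫ x, Real.exp (-logLR f0 f1 x) ∂P) := by
          rw [← ofReal_integral_eq_lintegral_ofReal hi (ae_of_all _ hpt0),
            integral_add hi' (hexpint.const_mul _),
            integral_add (integrable_const _) hint, integral_const_mul]
          simp
      _ ≤ ENNReal.ofReal ((v + Real.exp (-v)) + ∫ x, logLR f0 f1 x ∂P) := by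
          refine ENNReal.ofReal_le_ofReal ?_
          have := mul_le_of_le_one_right (Real.exp_pos (-v)).le hexp1
          linarith
      _ = _ := ENNReal.ofReal_add (add_nonneg hv (Real.exp_pos _).le) hpos.le
  · intro v _ hv
    have hv : A ≤ v := hv
    exact ENNReal.ofReal_le_ofReal (by linarith [Real.exp_pos (-v)])

end Hitting

section Delay

variable {P : Measure 𝓧} [IsProbabilityMeasure P] {f0 f1 : 𝓧 → ℝ} {μ : ℝ} {h : ℝ≥0}

lemma decusumStep_mem_Ico (hμ : 0 < μ) {A v : ℝ} (hv : v ∈ Set.Ico (-h : ℝ) A) (x : 𝓧)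
    (hx : decusumStep f0 f1 μ h v x ∉ Set.Ici A) :
    decusumStep f0 f1 μ h v x ∈ Set.Ico (-h : ℝ) A := by
  refine ⟨?_, by simpa using hx⟩
  unfold decusumStep
  split_ifs with h0
  · rw [trunc_coe]
    exact le_max_right _ _
  · exact le_min (by linarith [hv.1]) (by simp)

lemma neg_le_decusum (hμ : 0 < μ) (n : ℕ) (ω : ℕ → 𝓧) : -(h : ℝ) ≤ decusum f0 f1 μ h n ω := by
  induction n with
  | zero => simp [decusum]
  | succ n ih =>
    simp only [decusum]
    split_ifs
    · rw [trunc_coe]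
      exact le_max_right _ _
    · exact le_min (by linarith) (by simp)

/-- The mean time that DE-CuSum needs to reach `A` from an arbitrary state, after the change. The
Lyapunov function has two parts. The part `(A + M - w) / δ` pays for the used observations, whose
log-likelihood ratio, truncated from above at `M`, has mean `δ`. The other part pays for the skipped
ones. With `p w = E[min (1, e^{-(w + ℓ)})]`, a superharmonic majorant of the probability that the
walk started from `w` ever becomes negative, the number of excursions below `0` is dominated by a
geometric variable with parameter `p 0 < 1`; each of them lasts at most `1 + h / μ` steps. This
second part is bounded by a constant `c` that depends neither on `A` nor on `M`. -/
lemma exists_lintegral_hitTime_decusum_le (hl : Measurable (logLR f0 f1))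
    (hint : Integrable (logLR f0 f1) P) (hpos : 0 < ∫ x, logLR f0 f1 x ∂P)
    (hexp : ∫⁻ x, ENNReal.ofReal (Real.exp (-logLR f0 f1 x)) ∂P ≤ 1) (hμ : 0 < μ) :
    ∃ c : ℝ, 0 ≤ c ∧ ∀ A M : ℝ, 0 < ∫ x, min (logLR f0 f1 x) M ∂P →
      ∀ w ∈ Set.Ico (-h : ℝ) A,
        ∫⁻ ω, (hitTime (decusumStep f0 f1 μ h) (Set.Ici A) w ω : ℝ≥0∞) ∂iidLaw P ≤
          ENNReal.ofReal ((A + M + h) / ∫ x, min (logLR f0 f1 x) M ∂P) + ENNReal.ofReal c := by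
  set r := ∫ x, min 1 (Real.exp (-logLR f0 f1 x)) ∂P with hr
  have hr1 : r < 1 := integral_min_one_exp_lt_one hint hpos
  have hmin0 : ∀ y : ℝ, 0 ≤ min 1 (Real.exp (-y)) := fun y => le_min zero_le_one (Real.exp_pos _).le
  have hr0 : 0 ≤ r := integral_nonneg fun x => hmin0 _
  set b : ℝ := 1 + h / μ with hb
  have hb0 : 0 ≤ b := by positivity
  have hK0 : 0 ≤ b * (1 - r)⁻¹ := mul_nonneg hb0 (inv_nonneg.2 (by linarith))
  set β : ℝ≥0∞ := ENNReal.ofReal (b * (1 - r)⁻¹) with hβ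
  set q : ℝ → ℝ≥0∞ := fun w =>
    ∫⁻ x, ENNReal.ofReal (min 1 (Real.exp (-(w + logLR f0 f1 x)))) ∂P with hq
  have hqm : Measurable q :=
    Measurable.lintegral_prod_right' (f := fun p : ℝ × 𝓧 =>
      ENNReal.ofReal (min 1 (Real.exp (-(p.1 + logLR f0 f1 p.2))))) (by fun_prop)
  have hq0 : q 0 = ENNReal.ofReal r := by
    simp only [hq, zero_add, hr]
    refine (ofReal_integral_eq_lintegral_ofReal ?_ (ae_of_all _ fun x => hmin0 _)).symm
    refine Integrable.mono' (integrable_const (1 : ℝ)) (by fun_prop) (ae_of_all _ fun x => ?_)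
    rw [Real.norm_of_nonneg (hmin0 _)]
    exact min_le_left _ _
  have hqle1 : ∀ w, q w ≤ 1 := fun w => by
    refine (lintegral_mono (g := fun _ => 1) fun x => ?_).trans (by simp)
    exact ENNReal.ofReal_le_one.2 (min_le_left _ _)
  have hqle : ∀ w, q w ≤ ENNReal.ofReal (Real.exp (-w)) := fun w => by
    calc q w ≤ ∫⁻ x, ENNReal.ofReal (Real.exp (-w)) *
          ENNReal.ofReal (Real.exp (-logLR f0 f1 x)) ∂P := by
          refine lintegral_mono fun x => ?_
          rw [← ENNReal.ofReal_mul (Real.exp_pos _).le, ← Real.exp_add, ← neg_add]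
          exact ENNReal.ofReal_le_ofReal (min_le_right _ _)
      _ ≤ ENNReal.ofReal (Real.exp (-w)) := by
          rw [lintegral_const_mul _ (by fun_prop)]
          exact mul_le_of_le_one_right' hexp
  -- The mean cost `β` of an excursion and of what follows it.
  have hfix : ENNReal.ofReal b + β * q 0 = β := by
    rw [hq0, hβ, ← ENNReal.ofReal_mul hK0, ← ENNReal.ofReal_add hb0 (mul_nonneg hK0 hr0)]
    congr 1
    have : (1 - r) ≠ 0 := by linarith
    field_simp
    ring
  refine ⟨b + b * (1 - r)⁻¹, add_nonneg hb0 hK0, fun A M hδ w hw => ?_⟩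
  set δ := ∫ x, min (logLR f0 f1 x) M ∂P with hδdef
  set L : ℝ → ℝ≥0∞ := fun w => ENNReal.ofReal ((A + M - w) / δ) with hL
  set E : ℝ → ℝ≥0∞ := fun w =>
    if w < 0 then ENNReal.ofReal (1 - w / μ) + β * q 0 else β * q w with hE
  have hLm : Measurable L := by fun_prop
  have hEm : Measurable E := by
    refine Measurable.ite measurableSet_Iio ?_ (hqm.const_mul β)
    fun_prop
  have hLanti : ∀ {y z : ℝ}, y ≤ z → L z ≤ L y := fun hyz =>
    ENNReal.ofReal_le_ofReal (div_le_div_of_nonneg_right (by linarith) hδ.le)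
  have hEneg : ∀ y : ℝ, -(h : ℝ) ≤ y → y < 0 → E y ≤ β := fun y hy hy0 => by
    simp only [hE, if_pos hy0]
    refine le_trans ?_ hfix.le
    gcongr
    rw [hb, sub_eq_add_neg, ← neg_div]
    gcongr
    linarith
  have hEpos : ∀ y : ℝ, 0 ≤ y → E y = β * q y := fun y hy => if_neg hy.not_gt
  have hEle : ∀ y : ℝ, -(h : ℝ) ≤ y → E y ≤ β := fun y hy => by
    rcases lt_or_ge y 0 with hy0 | hy0
    · exact hEneg y hy hy0
    · rw [hEpos y hy0]
      exact mul_le_of_le_one_right' (hqle1 y)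
  have hbound : (L w + E w : ℝ≥0∞) ≤
      ENNReal.ofReal ((A + M + h) / δ) + ENNReal.ofReal (b + b * (1 - r)⁻¹) := by
    refine add_le_add (ENNReal.ofReal_le_ofReal ?_) ((hEle w hw.1).trans ?_)
    · exact div_le_div_of_nonneg_right (by linarith [hw.1]) hδ.le
    · exact ENNReal.ofReal_le_ofReal (by linarith)
  refine le_trans (lintegral_hitTime_le (measurable_decusumStep hl) measurableSet_Ici
    (hLm.add hEm) hw (fun v hv x hx => decusumStep_mem_Ico hμ hv x hx) fun v hv => ?_) hbound
  simp only [Pi.add_apply]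
  rcases lt_or_ge v 0 with hv0 | hv0
  · have hstep : ∀ x, decusumStep f0 f1 μ h v x = min (v + μ) 0 := fun x => if_neg hv0.not_ge
    simp only [hstep, lintegral_const, measure_univ, mul_one]
    have h1 : L (min (v + μ) 0) ≤ L v := hLanti (le_min (by linarith) hv0.le)
    have h2 : 1 + E (min (v + μ) 0) ≤ E v := by
      simp only [hE, if_pos hv0]
      rcases lt_or_ge (v + μ) 0 with hvμ | hvμ
      · rw [min_eq_left hvμ.le, if_pos hvμ, ← add_assoc, ← ENNReal.ofReal_one,
          ← ENNReal.ofReal_add zero_le_one]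
        · gcongr
          refine le_of_eq ?_
          field_simp
          ring
        · have : (v + μ) / μ < 0 := div_neg_of_neg_of_pos hvμ hμ
          linarith
      · rw [min_eq_right hvμ, if_neg (lt_irrefl 0)]
        gcongr
        rw [ENNReal.one_le_ofReal]
        have : v / μ < 0 := div_neg_of_neg_of_pos hv0 hμ
        linarith
    calc 1 + (L (min (v + μ) 0) + E (min (v + μ) 0))
        = L (min (v + μ) 0) + (1 + E (min (v + μ) 0)) := by ring
      _ ≤ L v + E v := add_le_add h1 h2
  · have hstep : ∀ x, decusumStep f0 f1 μ h v x = max (v + logLR f0 f1 x) (-h) := fun x => by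
      rw [decusumStep, if_pos hv0, trunc_coe]
    have hm : Measurable fun x => decusumStep f0 f1 μ h v x := by
      simp only [hstep]; fun_prop
    rw [lintegral_add_left (f := fun x => L (decusumStep f0 f1 μ h v x)) (hLm.comp hm),
      ← add_assoc]
    refine add_le_add ?_ ?_
    · have hiM : Integrable (fun x => min (logLR f0 f1 x) M) P := hint.inf (integrable_const _)
      have hi' : Integrable (fun x => (A + M - v) - min (logLR f0 f1 x) M) P :=
        (integrable_const (A + M - v)).sub hiM
      have hi : Integrable (fun x => ((A + M - v) - min (logLR f0 f1 x) M) / δ) P :=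
        hi'.div_const δ
      have hval : ∫ x, ((A + M - v) - min (logLR f0 f1 x) M) / δ ∂P = (A + M - v) / δ - 1 := by
        rw [integral_div, integral_sub (integrable_const _) hiM]
        simp only [integral_const, probReal_univ, one_smul]
        rw [← hδdef]
        field_simp
      have hpt : ∀ x, 0 ≤ ((A + M - v) - min (logLR f0 f1 x) M) / δ := fun x =>
        div_nonneg (by linarith [min_le_right (logLR f0 f1 x) M, hv.2]) hδ.le
      have hnn : 0 ≤ (A + M - v) / δ - 1 := hval ▸ integral_nonneg hpt
      calc 1 + ∫⁻ x, L (decusumStep f0 f1 μ h v x) ∂P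
          ≤ 1 + ∫⁻ x, ENNReal.ofReal (((A + M - v) - min (logLR f0 f1 x) M) / δ) ∂P := by
            gcongr with x
            refine ENNReal.ofReal_le_ofReal (div_le_div_of_nonneg_right ?_ hδ.le)
            rw [hstep]
            linarith [min_le_left (logLR f0 f1 x) M, le_max_left (v + logLR f0 f1 x) (-(h : ℝ))]
        _ = ENNReal.ofReal 1 + ENNReal.ofReal ((A + M - v) / δ - 1) := by
            rw [← ofReal_integral_eq_lintegral_ofReal hi (ae_of_all _ hpt), hval,
              ENNReal.ofReal_one]
        _ = L v := by
            rw [← ENNReal.ofReal_add zero_le_one hnn, hL]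
            congr 1
            ring
    · rw [hEpos v hv0, hq, ← lintegral_const_mul _ (by fun_prop)]
      refine lintegral_mono fun x => ?_
      rw [hstep]
      rcases lt_or_ge (v + logLR f0 f1 x) 0 with hy | hy
      · rw [min_eq_left (Real.one_le_exp (by linarith)), ENNReal.ofReal_one, mul_one]
        exact hEle _ (le_max_right _ _)
      · have hh : -(h : ℝ) ≤ v + logLR f0 f1 x := le_trans (by simp) hy
        rw [max_eq_left hh, hEpos _ hy, min_eq_right (Real.exp_le_one_iff.2 (by linarith))]
        gcongr
        exact hqle _

end Delay

/-! ### Worst-case average detection delay -/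

lemma hitTime_le_add {φ : ℝ → 𝓧 → ℝ} {B : Set ℝ} (w : ℝ) (k : ℕ) (ω : ℕ → 𝓧) :
    hitTime φ B w ω ≤ k + hitTime φ B (chain φ w k ω) (shift k ω) := by
  by_contra! hlt
  obtain ⟨n, hn⟩ : ∃ n : ℕ, hitTime φ B (chain φ w k ω) (shift k ω) = n := by
    refine ⟨_, (ENat.natCast_toNat ?_).symm⟩
    rintro htop
    simp [htop] at hlt
  rw [hn] at hlt
  have hlt' : ((k + n : ℕ) : ℕ∞) < hitTime φ B w ω := by exact_mod_cast hlt
  rw [lt_hitTime_iff] at hlt'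
  refine lt_irrefl (n : ℕ∞) ?_
  conv_rhs => rw [← hn]
  refine lt_hitTime_iff.2 fun m h1 h2 => ?_
  rw [← chain_add]
  exact hlt' _ (by omega) (by omega)

lemma measurable_hitTime {φ : ℝ → 𝓧 → ℝ} {B : Set ℝ} (hφ : Measurable (Function.uncurry φ))
    (hB : MeasurableSet B) (w : ℝ) :
    Measurable fun ω : ℕ → 𝓧 => (hitTime φ B w ω : ℝ≥0∞) := by
  simp_rw [toENNReal_eq_tsum (hitTime _ _ _ _)]
  exact Measurable.tsum fun n =>
    measurable_one.indicator (measurableSet_lt_hitTime hφ hB w n)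

lemma info_le {S : ℕ → (ℕ → 𝓧) → ℕ} (hS : ∀ n, Measurable (S n)) (k : ℕ) :
    info S k ≤ (inferInstance : MeasurableSpace (ℕ → 𝓧)) := by
  refine iSup₂_le fun j _ => ?_
  rw [← measurable_iff_comap_le]
  exact Measurable.ite (hS (j + 1) (measurableSet_singleton 1))
    (measurable_inl.comp (measurable_pi_apply j)) measurable_const

/-- The events known at time `k` are determined by the first `k` observations. -/
lemma splice_mem_iff_of_info {S : ℕ → (ℕ → 𝓧) → ℕ} {k : ℕ}
    (hS : ∀ j < k, ∀ ω ω', S (j + 1) (splice k ω ω') = S (j + 1) ω) {s : Set (ℕ → 𝓧)}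
    (hs : MeasurableSet[info S k] s) (ω ω' : ℕ → 𝓧) : splice k ω ω' ∈ s ↔ ω ∈ s := by
  let m : MeasurableSpace (ℕ → 𝓧) :=
    { MeasurableSet' := fun s => ∀ ω ω', splice k ω ω' ∈ s ↔ ω ∈ s
      measurableSet_empty := fun ω ω' => Iff.rfl
      measurableSet_compl := fun s hs ω ω' => not_congr (hs ω ω')
      measurableSet_iUnion := fun f hf ω ω' => by simp [hf _ ω ω'] }
  have hle : info S k ≤ m := by
    refine iSup₂_le fun j hj => ?_
    rintro _ ⟨t, -, rfl⟩ ω ω'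
    simp only [Set.mem_preimage, hS j hj, splice_of_lt hj]
  exact hle s hs ω ω'

section WADD

variable {ν : Measure 𝓧} {f0 f1 : 𝓧 → ℝ} {μ : ℝ} {h : ℝ≥0}

/-- The worst-case delay of DE-CuSum is at most the largest mean passage time to `A` from a state
below `A`. -/
lemma WADD_decusum_le (hf0 : IsPdf ν f0) (hf1 : IsPdf ν f1) (hμ : 0 < μ) {A : ℝ} (hA : 0 < A)
    {b : ℝ≥0∞} (hb : ∀ w ∈ Set.Ico (-h : ℝ) A,
      ∫⁻ ω, (hitTime (decusumStep f0 f1 μ h) (Set.Ici A) w ω : ℝ≥0∞) ∂iidLaw (law ν f1) ≤ b) :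
    WADD ν f0 f1 (decusumTime f0 f1 μ h A) (decusumControl f0 f1 μ h) ≤ b := by
  have hl := hf0.measurable_logLR hf1
  refine iSup₂_le fun γ hγ => ?_
  obtain ⟨k, rfl⟩ : ∃ k, γ = k + 1 := ⟨γ - 1, by omega⟩
  rw [Nat.add_sub_cancel]
  have := isProbabilityMeasure_changeLaw (ν := ν) hf0 hf1 ((k + 1 : ℕ) : ℕ∞)
  have hle := info_le (𝓧 := 𝓧) (measurable_decusumControl (μ := μ) (h := h) hl) k
  refine essSup_le_of_ae_le _ (ae_le_of_ae_le_trim (hm := hle) ?_)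
  refine ae_le_of_forall_setLIntegral_le_of_sigmaFinite (measurable_condLExp _ _ _) ?_
  intro s hs _
  rw [setLIntegral_condLExp_trim hle _ _ hs, setLIntegral_trim hle measurable_const hs]
  have hs' := hle s hs
  have hmem := fun ω ω' => splice_mem_iff_of_info (k := k) (fun j hj ω ω' => by
    rw [decusumControl_succ, decusumControl_succ, decusum_splice hj.le]) hs ω ω'
  have hτm : Measurable fun ω : ℕ → 𝓧 =>
      (decusumTime f0 f1 μ h A ω : ℝ≥0∞) - ((k + 1 : ℕ) : ℝ≥0∞) := by
    simp_rw [decusumTime_eq_hitTime]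
    exact (measurable_hitTime (measurable_decusumStep hl) measurableSet_Ici 0).sub_const _
  rw [← lintegral_indicator hs', ← lintegral_indicator hs',
    lintegral_changeLaw hf0 hf1 k (hτm.indicator hs'),
    lintegral_changeLaw hf0 hf1 k (measurable_const.indicator hs')]
  refine lintegral_mono fun ω => ?_
  by_cases hω : ω ∈ s
  swap
  · refine lintegral_mono fun ω' => ?_
    simp [hmem, hω]
  have := hf1.isProbabilityMeasure_law
  simp only [Set.indicator_of_mem ((hmem _ _).2 hω), lintegral_const, measure_univ, mul_one]
  set w := chain (decusumStep f0 f1 μ h) 0 k ω with hw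
  by_cases hwA : w < A
  · have hwh : -(h : ℝ) ≤ w := by
      rw [hw, ← decusum_eq_chain]
      exact neg_le_decusum hμ k ω
    refine le_trans (lintegral_mono fun ω' => ?_) (hb w ⟨hwh, hwA⟩)
    rw [tsub_le_iff_left, decusumTime_eq_hitTime]
    have hadd := hitTime_le_add (φ := decusumStep f0 f1 μ h) (B := Set.Ici A) 0 k (splice k ω ω')
    rw [shift_splice, chain_splice 0 le_rfl, ← hw] at hadd
    calc (hitTime (decusumStep f0 f1 μ h) (Set.Ici A) 0 (splice k ω ω') : ℝ≥0∞)
        ≤ ((k + hitTime (decusumStep f0 f1 μ h) (Set.Ici A) w ω' : ℕ∞) : ℝ≥0∞) := by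
          exact_mod_cast hadd
      _ ≤ _ := by
          push_cast
          gcongr
          exact le_self_add
  · have hk : 1 ≤ k := by
      by_contra hk
      obtain rfl : k = 0 := by omega
      exact hwA hA
    refine le_trans (le_of_eq ?_) zero_le
    refine (lintegral_congr fun ω' => ?_).trans lintegral_zero
    have hle' : decusumTime f0 f1 μ h A (splice k ω ω') ≤ k := by
      refine firstTime_le hk ?_
      rw [decusum_splice le_rfl, decusum_eq_chain]
      exact not_lt.1 hwA
    refine tsub_eq_zero_of_le ?_
    calc (decusumTime f0 f1 μ h A (splice k ω ω') : ℝ≥0∞) ≤ ((k : ℕ∞) : ℝ≥0∞) := by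
          exact_mod_cast hle'
      _ ≤ _ := by simp

/-- A change at time `1` gives a lower bound on the worst-case delay. -/
lemma lintegral_le_WADD_add_one (hf1 : IsPdf ν f1)
    (τ : (ℕ → 𝓧) → ℕ∞) (S : ℕ → (ℕ → 𝓧) → ℕ) :
    ∫⁻ ω, (τ ω : ℝ≥0∞) ∂iidLaw (law ν f1) ≤ WADD ν f0 f1 τ S + 1 := by
  have := hf1.isProbabilityMeasure_law
  have hbot : info S 0 = ⊥ := by simp [info]
  have h1 : ∫⁻ ω, ((τ ω : ℝ≥0∞) - 1) ∂iidLaw (law ν f1) ≤ WADD ν f0 f1 τ S := by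
    refine le_trans (le_of_eq ?_) (le_iSup₂ (f := fun (γ : ℕ) (_ : 1 ≤ γ) =>
      essSup (condLExp (info S (γ - 1)) (changeLaw ν f0 f1 γ)
        (fun ω => (τ ω : ℝ≥0∞) - (γ : ℝ≥0∞))) (changeLaw ν f0 f1 γ)) 1 le_rfl)
    simp only [Nat.cast_one, Nat.sub_self, changeLaw_one_eq, hbot, condLExp_bot]
    rw [essSup_const _ (NeZero.ne _)]
  calc ∫⁻ ω, (τ ω : ℝ≥0∞) ∂iidLaw (law ν f1)
      ≤ ∫⁻ ω, ((τ ω : ℝ≥0∞) - 1 + 1) ∂iidLaw (law ν f1) := lintegral_mono fun ω => le_tsub_add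
    _ = ∫⁻ ω, ((τ ω : ℝ≥0∞) - 1) ∂iidLaw (law ν f1) + 1 := by
        rw [lintegral_add_right _ measurable_const]
        simp
    _ ≤ _ := by gcongr

end WADD

/-- A function squeezed between two almost linear bounds with slopes close to `1 / D` is
asymptotically linear with slope `1 / D`. -/
lemma tendsto_div_of_linear_bounds {F δ : ℝ → ℝ} {D c c' : ℝ} (hD : 0 < D)
    (hδ : Tendsto δ atTop (𝓝 D)) (hlow : ∀ A, 0 < A → (A - 1) / D - 1 ≤ F A)
    (hup : ∀ A, 0 < A → ∀ M, 0 ≤ M → 0 < δ M → F A ≤ (A + M + c) / δ M + c') :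
    Tendsto (fun A => F A / A) atTop (𝓝 (1 / D)) := by
  have key : ∀ a b : ℝ, Tendsto (fun A : ℝ => a + b / A) atTop (𝓝 a) := fun a b => by
    simpa using (tendsto_const_nhds (x := a)).add (tendsto_const_nhds.div_atTop tendsto_id)
  refine tendsto_order.2 ⟨fun a ha => ?_, fun a ha => ?_⟩
  · filter_upwards [(key (1 / D) (-(1 / D) - 1)).eventually_const_lt ha, eventually_gt_atTop 0]
      with A hA hA0
    refine hA.trans_le ?_
    rw [le_div_iff₀ hA0]
    refine le_trans (le_of_eq ?_) (hlow A hA0)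
    field_simp
    ring
  · have hinv : Tendsto (fun M => 1 / δ M) atTop (𝓝 (1 / D)) := tendsto_const_nhds.div hδ hD.ne'
    obtain ⟨M, hM, hM0, hMδ⟩ := ((hinv.eventually_lt_const ha).and
      ((eventually_ge_atTop 0).and (hδ.eventually_const_lt hD))).exists
    filter_upwards [(key (1 / δ M) ((M + c) / δ M + c')).eventually_lt_const hM,
      eventually_gt_atTop 0] with A hA hA0
    refine lt_of_le_of_lt ?_ hA
    rw [div_le_iff₀ hA0]
    refine (hup A hA0 M hM0 hMδ).trans (le_of_eq ?_)
    field_simp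
    ring

section WADDAsymptotics

variable {ν : Measure 𝓧} [SigmaFinite ν] {f0 f1 : 𝓧 → ℝ} {μ : ℝ}

lemma WADD_decusum_isEquivalent (hf0 : IsPdf ν f0) (hf1 : IsPdf ν f1)
    (hD1_pos : 0 < InformationTheory.klDiv (law ν f1) (law ν f0))
    (hD1_fin : InformationTheory.klDiv (law ν f1) (law ν f0) < ∞)
    (hD0_fin : InformationTheory.klDiv (law ν f0) (law ν f1) < ∞)
    (hμ : 0 < μ) (h : ℝ≥0) :
    (fun α : ℝ => (WADD ν f0 f1 (decusumTime f0 f1 μ h |Real.log α|)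
        (decusumControl f0 f1 μ h)).toReal) ~[𝓝[>] 0]
      (fun α : ℝ => |Real.log α| / (InformationTheory.klDiv (law ν f1) (law ν f0)).toReal) := by
  have hP1 := hf1.isProbabilityMeasure_law
  set D := (InformationTheory.klDiv (law ν f1) (law ν f0)).toReal with hDdef
  have hD : 0 < D := ENNReal.toReal_pos hD1_pos.ne' hD1_fin.ne
  have hl := hf0.measurable_logLR hf1
  have hint := integrable_logLR hf0 hf1 hD1_fin
  have hmean : ∫ x, logLR f0 f1 x ∂law ν f1 = D := integral_logLR hf0 hf1 hD1_fin
  have hexp : ∫⁻ x, ENNReal.ofReal (Real.exp (-logLR f0 f1 x)) ∂law ν f1 ≤ 1 := by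
    simpa only [logLR_swap (f0 := f0) (f1 := f1)] using lintegral_exp_logLR_le hf1 hf0
      (InformationTheory.klDiv_ne_top_iff.1 hD0_fin.ne).1
      (InformationTheory.klDiv_ne_top_iff.1 hD1_fin.ne).1
  obtain ⟨c, hc, hbound⟩ := exists_lintegral_hitTime_decusum_le (h := h) hl hint
    (hmean ▸ hD) hexp hμ
  set W : ℝ → ℝ≥0∞ := fun A =>
    WADD ν f0 f1 (decusumTime f0 f1 μ h A) (decusumControl f0 f1 μ h) with hW
  set δ : ℝ → ℝ := fun M => ∫ x, min (logLR f0 f1 x) M ∂law ν f1 with hδdef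
  have hδ : Tendsto δ atTop (𝓝 D) := hmean ▸ tendsto_integral_min hint
  have hup : ∀ A, 0 < A → ∀ M, 0 < δ M →
      W A ≤ ENNReal.ofReal ((A + M + h) / δ M) + ENNReal.ofReal c := fun A hA M hM =>
    WADD_decusum_le hf0 hf1 hμ hA (hbound A M hM)
  obtain ⟨M₀, hM₀⟩ := (hδ.eventually_const_lt hD).exists
  have hfin : ∀ A, 0 < A → W A ≠ ∞ := fun A hA =>
    ((hup A hA M₀ hM₀).trans_lt (by simp)).ne
  have hlim : Tendsto (fun A => (W A).toReal / A) atTop (𝓝 (1 / D)) := by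
    refine tendsto_div_of_linear_bounds (δ := δ) (c := h) (c' := c) hD hδ (fun A hA => ?_)
      fun A hA M hM hMδ => ?_
    · have h1 := le_lintegral_cusumTime hl hint (hmean ▸ hD) hexp A
      have h2 : ∫⁻ ω, (cusumTime f0 f1 A ω : ℝ≥0∞) ∂iidLaw (law ν f1) ≤ W A + 1 := by
        refine (lintegral_mono fun ω => ?_).trans (lintegral_le_WADD_add_one hf1
          (decusumTime f0 f1 μ h A) (decusumControl f0 f1 μ h))
        exact ENat.toENNReal_le.2 (cusumTime_le_decusumTime A ω)
      have h3 : ENNReal.ofReal A ≤ ENNReal.ofReal (1 + D * ((W A).toReal + 1)) := by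
        rw [hmean] at h1
        calc ENNReal.ofReal A ≤ 1 + ENNReal.ofReal D * (W A + 1) := h1.trans (by gcongr)
          _ = _ := by
            rw [ENNReal.ofReal_add zero_le_one (by positivity), ENNReal.ofReal_one,
              ENNReal.ofReal_mul hD.le, ENNReal.ofReal_add ENNReal.toReal_nonneg zero_le_one,
              ENNReal.ofReal_toReal (hfin A hA), ENNReal.ofReal_one]
      have h4 := (ENNReal.ofReal_le_ofReal_iff (by positivity)).1 h3
      rw [sub_le_iff_le_add, div_le_iff₀ hD]
      linarith
    · by_cases hAM : 0 ≤ (A + M + h) / δ M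
      · refine ENNReal.toReal_le_of_le_ofReal (add_nonneg hAM hc) ?_
        rw [ENNReal.ofReal_add hAM hc]
        exact hup A hA M hMδ
      · exact absurd (by positivity) hAM
  have hlog : Tendsto (fun α : ℝ => |Real.log α|) (𝓝[>] 0) atTop :=
    tendsto_abs_atBot_atTop.comp Real.tendsto_log_nhdsGT_zero
  refine Asymptotics.isEquivalent_of_tendsto_one ?_
  have := (hlim.comp hlog).mul_const D
  rw [one_div, inv_mul_cancel₀ hD.ne'] at this
  refine this.congr fun α => ?_
  simp only [Function.comp, Pi.div_apply, hW]
  rw [div_div_eq_mul_div, div_mul_eq_mul_div]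

lemma WADD_cusum_eq (A : ℝ) : WADD ν f0 f1 (cusumTime f0 f1 A) cusumControl =
    WADD ν f0 f1 (decusumTime f0 f1 μ (0 : ℝ≥0) A) (decusumControl f0 f1 μ (0 : ℝ≥0)) := by
  have h1 : cusumTime f0 f1 A = decusumTime f0 f1 μ (0 : ℝ≥0) A := by
    funext ω
    simp only [cusumTime, decusumTime, cusum_eq_decusum_zero (μ := μ)]
  have h2 : ∀ n (ω : ℕ → 𝓧), decusumControl f0 f1 μ (0 : ℝ≥0) (n + 1) ω = cusumControl (n + 1) ω :=
    fun n ω => by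
      rw [decusumControl_succ, ← cusum_eq_decusum_zero, if_pos (cusum_nonneg n ω), cusumControl]
  have h3 : ∀ n, info (decusumControl f0 f1 μ (0 : ℝ≥0)) n = info (𝓧 := 𝓧) cusumControl n :=
    fun n => by simp only [info, h2]
  simp only [WADD, h1, h3]

end WADDAsymptotics

/-! ### The duty cycle before the change -/

section DutyCycle

variable {ν : Measure 𝓧} {f0 f1 : 𝓧 → ℝ} {μ : ℝ} {h : ℝ≥0∞}

lemma lintegral_dutyCycle (hf0 : IsPdf ν f0) (hf1 : IsPdf ν f1) (k : ℕ) :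
    ∫⁻ ω, ((∑ n ∈ Finset.Ico 1 (k + 1), decusumControl f0 f1 μ h n ω : ℕ) : ℝ≥0∞) /
        ((k + 1 : ℕ) : ℝ≥0∞) ∂changeLaw ν f0 f1 ((k + 1 : ℕ) : ℕ∞) =
      ENNReal.ofReal ((∑ m ∈ Finset.range k,
        (iidLaw (law ν f0)).real {ω | 0 ≤ decusum f0 f1 μ h m ω}) / (k + 1 : ℕ)) := by
  have := hf0.isProbabilityMeasure_law
  have := hf1.isProbabilityMeasure_law
  have hl := hf0.measurable_logLR hf1
  have hS : ∀ m (ω : ℕ → 𝓧), ((decusumControl f0 f1 μ h (1 + m) ω : ℕ) : ℝ≥0∞) =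
      {ω | 0 ≤ decusum f0 f1 μ h m ω}.indicator 1 ω := fun m ω => by
    rw [add_comm, decusumControl_succ]
    by_cases h0 : 0 ≤ decusum f0 f1 μ h m ω <;> simp [h0]
  have hm : ∀ m ∈ Finset.range k, Measurable
      ({ω | 0 ≤ decusum f0 f1 μ h m ω}.indicator (1 : (ℕ → 𝓧) → ℝ≥0∞)) := fun m _ =>
    measurable_one.indicator (measurableSet_decusum_nonneg hl m)
  simp only [Finset.sum_Ico_eq_sum_range, Nat.add_sub_cancel, Nat.cast_sum, hS, div_eq_mul_inv]
  rw [lintegral_changeLaw hf0 hf1 k ((Finset.measurable_fun_sum _ hm).mul_const _),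
    ENNReal.ofReal_mul (Finset.sum_nonneg fun _ _ => measureReal_nonneg),
    ENNReal.ofReal_inv_of_pos (by positivity), ENNReal.ofReal_natCast,
    ENNReal.ofReal_sum_of_nonneg fun _ _ => measureReal_nonneg]
  simp only [ofReal_measureReal (measure_ne_top _ _)]
  have : ∀ ω ω' : ℕ → 𝓧, ∑ m ∈ Finset.range k,
      {ω | 0 ≤ decusum f0 f1 μ h m ω}.indicator (1 : (ℕ → 𝓧) → ℝ≥0∞) (splice k ω ω') =
      ∑ m ∈ Finset.range k,
        {ω | 0 ≤ decusum f0 f1 μ h m ω}.indicator (1 : (ℕ → 𝓧) → ℝ≥0∞) ω := fun ω ω' =>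
    Finset.sum_congr rfl fun m hm => by
      simp only [Set.indicator, Set.mem_ofPred_eq, decusum_splice (Finset.mem_range.1 hm).le,
        Pi.one_apply]
  simp only [this, lintegral_const, measure_univ, mul_one]
  rw [lintegral_mul_const _ (Finset.measurable_fun_sum _ hm), lintegral_finsetSum _ hm]
  congr 1
  refine Finset.sum_congr rfl fun m _ => ?_
  exact lintegral_indicator_one (measurableSet_decusum_nonneg hl m)

lemma PDC_eq_of_tendsto (hf0 : IsPdf ν f0) (hf1 : IsPdf ν f1) {p : ℝ}
    (hp : Tendsto (fun N : ℕ => (∑ m ∈ Finset.range N,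
      (iidLaw (law ν f0)).real {ω | 0 ≤ decusum f0 f1 μ h m ω}) / N) atTop (𝓝 p)) :
    PDC ν f0 f1 (decusumControl f0 f1 μ h) = ENNReal.ofReal p := by
  refine Tendsto.limsup_eq ((tendsto_add_atTop_iff_nat 1).1 ?_)
  simp only [lintegral_dutyCycle hf0 hf1]
  refine (ENNReal.continuous_ofReal.tendsto p).comp ?_
  have := hp.mul (tendsto_natCast_div_add_atTop (1 : ℝ))
  rw [mul_one] at this
  refine this.congr' ?_
  filter_upwards [eventually_gt_atTop 0] with N hN
  push_cast
  field_simp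

lemma PDC_le_of_le (hf0 : IsPdf ν f0) (hf1 : IsPdf ν f1) {p c : ℝ}
    (hp : ∀ N : ℕ, (∑ m ∈ Finset.range N,
      (iidLaw (law ν f0)).real {ω | 0 ≤ decusum f0 f1 μ h m ω}) ≤ p * N + c) :
    PDC ν f0 f1 (decusumControl f0 f1 μ h) ≤ ENNReal.ofReal p := by
  unfold PDC
  rw [← limsup_nat_add _ 1]
  simp only [lintegral_dutyCycle hf0 hf1]
  have hlim : Tendsto (fun N : ℕ => ENNReal.ofReal ((p * N + c) / (N + 1 : ℕ))) atTop
      (𝓝 (ENNReal.ofReal p)) := by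
    refine (ENNReal.continuous_ofReal.tendsto p).comp ?_
    have h1 := (tendsto_natCast_div_add_atTop (1 : ℝ)).const_mul p
    have h2 := (tendsto_const_nhds (x := c)).div_atTop
      (tendsto_natCast_atTop_atTop.comp (tendsto_add_atTop_nat 1) : Tendsto
        (fun N : ℕ => ((N + 1 : ℕ) : ℝ)) atTop atTop)
    have := h1.add h2
    rw [mul_one, add_zero] at this
    refine this.congr fun N => ?_
    simp only [Function.comp_apply]
    push_cast
    ring
  rw [← hlim.limsup_eq]
  refine limsup_le_limsup (Eventually.of_forall fun N => ENNReal.ofReal_le_ofReal ?_)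
  exact div_le_div_of_nonneg_right (hp N) (by positivity)

end DutyCycle

/-! ### No truncation: a drift argument -/

section NoTruncation

variable {P : Measure 𝓧} [IsProbabilityMeasure P] {f0 f1 : 𝓧 → ℝ} {μ : ℝ}

lemma integrable_eval {g : 𝓧 → ℝ} (hg : Integrable g P) (n : ℕ) :
    Integrable (fun ω : ℕ → 𝓧 => g (ω n)) (iidLaw P) :=
  (measurePreserving_eval_infinitePi (fun _ : ℕ => P) n).integrable_comp_of_integrable hg

lemma integral_eval {g : 𝓧 → ℝ} (hg : Measurable g) (n : ℕ) :
    ∫ ω, g (ω n) ∂iidLaw P = ∫ x, g x ∂P := by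
  have := integral_map (μ := iidLaw P) (φ := fun ω : ℕ → 𝓧 => ω n)
    (measurable_pi_apply n).aemeasurable
    (f := g) hg.aestronglyMeasurable
  rwa [Measure.infinitePi_map_eval, eq_comm] at this

/-- An event determined by the first `n` observations is independent of the next one. -/
lemma integral_indicator_mul_eval {s : Set (ℕ → 𝓧)} (hs : MeasurableSet s) {n : ℕ}
    (hn : ∀ ω ω', splice n ω ω' ∈ s ↔ ω ∈ s) {g : 𝓧 → ℝ} (hg : Measurable g) :
    ∫ ω, s.indicator 1 ω * g (ω n) ∂iidLaw P = (iidLaw P).real s * ∫ x, g x ∂P := by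
  have hF : Measurable fun ω : ℕ → 𝓧 => s.indicator 1 ω * g (ω n) :=
    (measurable_one.indicator hs).mul (by fun_prop)
  rw [← (measurePreserving_splice_iid (P := P) n).map_eq,
    integral_map (measurable_splice n).aemeasurable hF.aestronglyMeasurable]
  have hsp : ∀ p : (ℕ → 𝓧) × (ℕ → 𝓧), s.indicator (1 : (ℕ → 𝓧) → ℝ) (splice n p.1 p.2) =
      s.indicator 1 p.1 := fun p => by
    by_cases hp : p.1 ∈ s <;> simp [hn, hp]
  simp only [hsp, splice_self]
  rw [integral_prod_mul (fun ω => s.indicator 1 ω) fun ω : ℕ → 𝓧 => g (ω 0), integral_eval hg,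
    integral_indicator_one hs, (measurePreserving_splice_iid (P := P) n).map_eq]

lemma trunc_top (x : ℝ) : trunc ∞ x = x := if_pos rfl

lemma integrable_decusum_top (hl : Measurable (logLR f0 f1))
    (hint : Integrable (logLR f0 f1) P) (n : ℕ) :
    Integrable (decusum f0 f1 μ ∞ n) (iidLaw P) := by
  induction n with
  | zero => exact integrable_const 0
  | succ n ih =>
    refine Integrable.mono' ((ih.abs.add (integrable_eval hint n).abs).add (integrable_const |μ|))
      (measurable_decusum hl _).aestronglyMeasurable (ae_of_all _ fun ω => ?_)
    simp only [decusum, trunc_top, Pi.add_apply, Real.norm_eq_abs]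
    split_ifs with h0
    · linarith [abs_add_le (decusum f0 f1 μ ∞ n ω) (logLR f0 f1 (ω n)), abs_nonneg μ]
    · have h1 := abs_add_le (decusum f0 f1 μ ∞ n ω) μ
      have h2 := abs_nonneg (logLR f0 f1 (ω n))
      rcases le_total (decusum f0 f1 μ ∞ n ω + μ) 0 with h3 | h3
      · rw [min_eq_left h3]
        linarith
      · rw [min_eq_right h3, abs_zero]
        positivity

/-- The drift of the untruncated statistic is `-D` while observations are used and at most `μ`
while they are skipped. -/
lemma integral_decusum_top_le (hl : Measurable (logLR f0 f1))
    (hint : Integrable (logLR f0 f1) P) (N : ℕ) :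
    ∫ ω, decusum f0 f1 μ ∞ N ω ∂iidLaw P ≤
      μ * N - (μ - ∫ x, logLR f0 f1 x ∂P) * ∑ m ∈ Finset.range N,
        (iidLaw P).real {ω | 0 ≤ decusum f0 f1 μ ∞ m ω} := by
  induction N with
  | zero => simp [decusum]
  | succ n ih =>
    set s : Set (ℕ → 𝓧) := {ω | 0 ≤ decusum f0 f1 μ ∞ n ω} with hs
    have hsm : MeasurableSet s := measurableSet_decusum_nonneg hl n
    have hi1 : Integrable (fun ω => s.indicator 1 ω * logLR f0 f1 (ω n)) (iidLaw P) := by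
      refine ((integrable_eval hint n).indicator hsm).congr (ae_of_all _ fun ω => ?_)
      by_cases hω : ω ∈ s <;> simp [hω]
    have hi2 : Integrable (fun ω => μ * (1 - s.indicator (1 : (ℕ → 𝓧) → ℝ) ω)) (iidLaw P) :=
      ((integrable_const (1 : ℝ)).sub ((integrable_const (1 : ℝ)).indicator hsm)).const_mul μ
    have hi0 := integrable_decusum_top (μ := μ) hl hint n
    have hi01 : Integrable (fun ω => decusum f0 f1 μ ∞ n ω +
      s.indicator 1 ω * logLR f0 f1 (ω n)) (iidLaw P) := hi0.add hi1
    have hstep : ∫ ω, decusum f0 f1 μ ∞ (n + 1) ω ∂iidLaw P ≤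
        ∫ ω, (decusum f0 f1 μ ∞ n ω + s.indicator 1 ω * logLR f0 f1 (ω n) +
          μ * (1 - s.indicator (1 : (ℕ → 𝓧) → ℝ) ω)) ∂iidLaw P := by
      refine integral_mono (integrable_decusum_top hl hint _) (hi01.add hi2) fun ω => ?_
      by_cases hω : 0 ≤ decusum f0 f1 μ ∞ n ω
      · simp [decusum, hs, hω, trunc_top]
      · simp [decusum, hs, hω]
    have hval : ∫ ω, μ * (1 - s.indicator (1 : (ℕ → 𝓧) → ℝ) ω) ∂iidLaw P =
        μ * (1 - (iidLaw P).real s) := by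
      rw [integral_const_mul, integral_sub (g := s.indicator 1) (integrable_const _)
        ((integrable_const (1 : ℝ)).indicator hsm), integral_indicator_one hsm]
      simp
    rw [integral_add hi01 hi2, integral_add hi0 hi1, hval,
      integral_indicator_mul_eval hsm (fun ω ω' => by
        simp only [hs, Set.mem_ofPred_eq, decusum_splice le_rfl]) hl] at hstep
    rw [Finset.sum_range_succ]
    push_cast
    linarith

/-- The untruncated statistic cannot fall much below `-M`, except through single observations whose
log-likelihood ratio is below `-M`. -/
lemma le_decusum_top (hμ : 0 < μ) {M : ℝ} (hM : 0 ≤ M) (n : ℕ) (ω : ℕ → 𝓧) :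
    -M - ∑ i ∈ Finset.range n, (max (logLR f0 f1 (ω i)) (-M) - logLR f0 f1 (ω i)) ≤
      decusum f0 f1 μ ∞ n ω := by
  have hnn : ∀ i, 0 ≤ max (logLR f0 f1 (ω i)) (-M) - logLR f0 f1 (ω i) := fun i =>
    sub_nonneg.2 (le_max_left _ _)
  induction n with
  | zero => simpa [decusum] using hM
  | succ n ih =>
    have hsum := Finset.sum_nonneg (s := Finset.range n) fun i _ => hnn i
    rw [Finset.sum_range_succ]
    simp only [decusum, trunc_top]
    split_ifs with h0
    · linarith [le_max_right (logLR f0 f1 (ω n)) (-M)]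
    · refine le_min ?_ ?_
      · linarith [hnn n]
      · linarith [hnn n]

lemma sum_measureReal_decusum_top_le (hl : Measurable (logLR f0 f1))
    (hint : Integrable (logLR f0 f1) P) (hμ : 0 < μ) {M : ℝ} (hM : 0 ≤ M) (N : ℕ) :
    (μ - ∫ x, logLR f0 f1 x ∂P) * ∑ m ∈ Finset.range N,
        (iidLaw P).real {ω | 0 ≤ decusum f0 f1 μ ∞ m ω} ≤
      (μ + (∫ x, max (logLR f0 f1 x) (-M) ∂P - ∫ x, logLR f0 f1 x ∂P)) * N + M := by
  have hiM : Integrable (fun x => max (logLR f0 f1 x) (-M)) P := hint.sup (integrable_const _)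
  have hi : ∀ i ∈ Finset.range N, Integrable (fun ω : ℕ → 𝓧 =>
      max (logLR f0 f1 (ω i)) (-M) - logLR f0 f1 (ω i)) (iidLaw P) := fun i _ =>
    integrable_eval (hiM.sub hint) i
  have h1 := integral_decusum_top_le (μ := μ) hl hint N
  have h2 : ∫ ω, (-M - ∑ i ∈ Finset.range N, (max (logLR f0 f1 (ω i)) (-M) -
      logLR f0 f1 (ω i))) ∂iidLaw P ≤ ∫ ω, decusum f0 f1 μ ∞ N ω ∂iidLaw P :=
    integral_mono ((integrable_const _).sub (integrable_finsetSum _ hi))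
      (integrable_decusum_top hl hint N) fun ω => le_decusum_top hμ hM N ω
  have h3 : ∀ i, ∫ ω : ℕ → 𝓧, (max (logLR f0 f1 (ω i)) (-M) - logLR f0 f1 (ω i)) ∂iidLaw P =
      ∫ x, max (logLR f0 f1 x) (-M) ∂P - ∫ x, logLR f0 f1 x ∂P := fun i => by
    rw [integral_eval (g := fun x => max (logLR f0 f1 x) (-M) - logLR f0 f1 x) (by fun_prop),
      integral_sub hiM hint]
  rw [integral_sub (integrable_const _) (integrable_finsetSum _ hi), integral_finsetSum _ hi] at h2
  simp only [h3, integral_const, probReal_univ, one_smul, Finset.sum_const, Finset.card_range,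
    nsmul_eq_mul] at h2
  linarith

end NoTruncation

lemma PDC_decusum_top_le {ν : Measure 𝓧} [SigmaFinite ν] {f0 f1 : 𝓧 → ℝ} {μ : ℝ}
    (hf0 : IsPdf ν f0) (hf1 : IsPdf ν f1)
    (hD0_fin : InformationTheory.klDiv (law ν f0) (law ν f1) < ∞) (hμ : 0 < μ) :
    PDC ν f0 f1 (decusumControl f0 f1 μ ∞) ≤
      ENNReal.ofReal (μ / (μ + (InformationTheory.klDiv (law ν f0) (law ν f1)).toReal)) := by
  have := hf0.isProbabilityMeasure_law
  set D := (InformationTheory.klDiv (law ν f0) (law ν f1)).toReal with hD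
  have hl := hf0.measurable_logLR hf1
  have hswap : logLR f0 f1 = fun x => -logLR f1 f0 x := funext fun x => logLR_swap x
  have hint : Integrable (logLR f0 f1) (law ν f0) := by
    rw [hswap]
    exact (integrable_logLR hf1 hf0 hD0_fin).neg
  have hmean : ∫ x, logLR f0 f1 x ∂law ν f0 = -D := by
    rw [hswap, integral_neg, integral_logLR hf1 hf0 hD0_fin]
  have hμD : 0 < μ + D := add_pos_of_pos_of_nonneg hμ ENNReal.toReal_nonneg
  have hlim : Tendsto (fun M => ENNReal.ofReal
      ((μ + (∫ x, max (logLR f0 f1 x) (-M) ∂law ν f0 - -D)) / (μ + D))) atTop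
      (𝓝 (ENNReal.ofReal (μ / (μ + D)))) := by
    refine (ENNReal.continuous_ofReal.tendsto _).comp ?_
    have := ((tendsto_integral_max_neg hint).sub_const (-D)).const_add μ |>.div_const (μ + D)
    rwa [hmean, sub_self, add_zero] at this
  refine ge_of_tendsto hlim ?_
  filter_upwards [eventually_ge_atTop 0] with M hM
  refine PDC_le_of_le (c := M / (μ + D)) hf0 hf1 fun N => ?_
  have := sum_measureReal_decusum_top_le hl hint hμ hM N
  rw [hmean, sub_neg_eq_add, mul_comm, ← le_div_iff₀ hμD] at this
  refine this.trans (le_of_eq ?_)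
  field_simp

/-! ### Finite truncation: a renewal argument -/

/-- The renewal–reward limit, in deterministic form. Here `u k` is the probability of a renewal at
time `k`, the sums of `a` and `b` are the mean numbers `a₀` and `b₀` of used and of skipped
observations in a cycle, `x n` is the probability that the observation after time `n` is used, and
`e N` corrects for the skipped part of the cycle in progress at time `N`. -/
lemma tendsto_average_of_renewal {u a b x e : ℕ → ℝ} {a₀ b₀ c : ℝ}
    (hu0 : ∀ k, 0 ≤ u k) (hu1 : ∀ k, u k ≤ 1) (ha : HasSum a a₀) (hb : HasSum b b₀)
    (hab : a₀ + b₀ ≠ 0) (he0 : ∀ N, 0 ≤ e N) (hec : ∀ N, e N ≤ c)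
    (hx : ∀ n, x n = ∑ k ∈ Finset.range (n + 1), u k * a (n - k))
    (hy : ∀ N, e N + ∑ n ∈ Finset.range N, (1 - x n) =
      ∑ n ∈ Finset.range N, ∑ k ∈ Finset.range (n + 1), u k * b (n - k)) :
    Tendsto (fun N : ℕ => (∑ n ∈ Finset.range N, x n) / N) atTop (𝓝 (a₀ / (a₀ + b₀))) := by
  set d : ℕ → ℝ := fun j => b₀ * ∑ i ∈ Finset.range j, a i - a₀ * ∑ i ∈ Finset.range j, b i with hd
  have hdlim : Tendsto (fun j => |d (j + 1)|) atTop (𝓝 0) := by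
    have h1 := (ha.tendsto_sum_nat.const_mul b₀).sub (hb.tendsto_sum_nat.const_mul a₀)
    rw [mul_comm a₀ b₀, sub_self] at h1
    simpa using ((tendsto_add_atTop_iff_nat 1).2 h1).abs
  have hces := hdlim.cesaro
  have hkey : ∀ N, ∑ k ∈ Finset.range N, u k * d (N - k) =
      (a₀ + b₀) * ∑ n ∈ Finset.range N, x n - a₀ * N - a₀ * e N := fun N => by
    have h1 : ∑ n ∈ Finset.range N, x n =
        ∑ k ∈ Finset.range N, u k * ∑ i ∈ Finset.range (N - k), a i := by
      simp only [hx, Finset.mul_sum]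
      exact Finset.sum_range_diag_flip N fun k i => u k * a i
    have h2 : ∑ n ∈ Finset.range N, ∑ k ∈ Finset.range (n + 1), u k * b (n - k) =
        ∑ k ∈ Finset.range N, u k * ∑ i ∈ Finset.range (N - k), b i := by
      simp only [Finset.mul_sum]
      exact Finset.sum_range_diag_flip N fun k i => u k * b i
    have h3 := hy N
    rw [h2, Finset.sum_sub_distrib] at h3
    simp only [Finset.sum_const, Finset.card_range, nsmul_eq_mul, mul_one] at h3
    have h4 : ∑ k ∈ Finset.range N, u k * d (N - k) =
        b₀ * ∑ k ∈ Finset.range N, u k * ∑ i ∈ Finset.range (N - k), a i -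
          a₀ * ∑ k ∈ Finset.range N, u k * ∑ i ∈ Finset.range (N - k), b i := by
      rw [Finset.mul_sum, Finset.mul_sum, ← Finset.sum_sub_distrib]
      refine Finset.sum_congr rfl fun k _ => ?_
      simp only [hd]
      ring
    rw [h4, ← h1, ← h3]
    ring
  have hbd : ∀ N, |∑ k ∈ Finset.range N, u k * d (N - k)| ≤
      ∑ j ∈ Finset.range N, |d (j + 1)| := fun N => by
    rw [← Finset.sum_range_reflect (fun j => |d (j + 1)|)]
    refine (Finset.abs_sum_le_sum_abs _ _).trans (Finset.sum_le_sum fun k hk => ?_)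
    have hk := Finset.mem_range.1 hk
    rw [abs_mul, abs_of_nonneg (hu0 k), show N - 1 - k + 1 = N - k by omega]
    exact mul_le_of_le_one_left (abs_nonneg _) (hu1 k)
  have h1 : Tendsto (fun N : ℕ => (∑ k ∈ Finset.range N, u k * d (N - k)) / N) atTop (𝓝 0) := by
    refine squeeze_zero_norm (fun N => ?_) hces
    rw [Real.norm_eq_abs, abs_div, Nat.abs_cast, div_eq_inv_mul]
    gcongr
    exact hbd N
  have h2 : Tendsto (fun N : ℕ => e N / N) atTop (𝓝 0) := by
    refine squeeze_zero (fun N => div_nonneg (he0 N) N.cast_nonneg) (fun N => ?_)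
      ((tendsto_const_nhds (x := c)).div_atTop tendsto_natCast_atTop_atTop)
    gcongr
    exact hec N
  have h3 := (((h1.add (h2.const_mul a₀)).add_const a₀).div_const (a₀ + b₀))
  rw [mul_zero, add_zero, zero_add] at h3
  refine h3.congr' ?_
  filter_upwards [eventually_gt_atTop 0] with N hN
  rw [hkey]
  field_simp
  ring

lemma walk_nonneg_of_lt {f0 f1 : 𝓧 → ℝ} {j : ℕ} {ω : ℕ → 𝓧}
    (hj : (j : ℕ∞) < ladderTime f0 f1 ω) : 0 ≤ walk f0 f1 j ω := by
  rcases Nat.eq_zero_or_pos j with rfl | hpos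
  · simp [walk]
  · exact not_lt.1 (lt_firstTime_iff.1 hj j hpos le_rfl)

lemma succ_lt_ladderTime_iff {f0 f1 : 𝓧 → ℝ} {j : ℕ} {ω : ℕ → 𝓧} :
    ((j + 1 : ℕ) : ℕ∞) < ladderTime f0 f1 ω ↔
      (j : ℕ∞) < ladderTime f0 f1 ω ∧ 0 ≤ walk f0 f1 (j + 1) ω := by
  constructor
  · exact fun h => ⟨lt_of_le_of_lt (by exact_mod_cast Nat.le_succ j) h, walk_nonneg_of_lt h⟩
  · rintro ⟨h, h'⟩
    refine lt_firstTime_iff.2 fun m h1 h2 => ?_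
    rcases h2.eq_or_lt with rfl | h2
    · exact not_lt.2 h'
    · exact lt_firstTime_iff.1 h m h1 (by omega)

lemma zero_lt_ladderTime {f0 f1 : 𝓧 → ℝ} (ω : ℕ → 𝓧) : ((0 : ℕ) : ℕ∞) < ladderTime f0 f1 ω :=
  lt_firstTime_iff.2 fun m h1 h2 => by omega

/-- The event that a cycle of the DE-CuSum statistic begins at time `n`: either `n = 0`, or the
statistic has just come back from below `0`, or an undershoot has been truncated to `0`. In each
case the statistic is `0`; the converse fails, since the walk may visit `0` within a cycle. -/
def renewalEvent (f0 f1 : 𝓧 → ℝ) (μ : ℝ) (h : ℝ≥0∞) : ℕ → Set (ℕ → 𝓧)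
  | 0 => Set.univ
  | n + 1 => {ω | (if 0 ≤ decusum f0 f1 μ h n ω then decusum f0 f1 μ h n ω + logLR f0 f1 (ω n)
      else decusum f0 f1 μ h n ω) < 0 ∧ 0 ≤ decusum f0 f1 μ h (n + 1) ω}

/-- The number of observations that are skipped from the state `w` on before the statistic is back
at `0`. -/
def remainingSkips (μ w : ℝ) : ℕ := ⌈-w / μ⌉₊

section Renewal

variable {P : Measure 𝓧} [IsProbabilityMeasure P] {f0 f1 : 𝓧 → ℝ} {μ : ℝ} {h : ℝ≥0∞}

lemma decusum_eq_zero_of_renewal {k : ℕ} {ω : ℕ → 𝓧} (hω : ω ∈ renewalEvent f0 f1 μ h k) :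
    decusum f0 f1 μ h k ω = 0 := by
  cases k with
  | zero => rfl
  | succ n =>
    obtain ⟨h1, h2⟩ := hω
    refine le_antisymm ?_ h2
    simp only [decusum]
    split_ifs at h1 ⊢ with h0
    · exact trunc_nonpos h1.le
    · exact min_le_right _ _

/-- Within a cycle, and until it becomes negative, the statistic is the walk that starts at the
beginning of the cycle. -/
lemma decusum_eq_walk {k : ℕ} {ω : ℕ → 𝓧} (hω : ω ∈ renewalEvent f0 f1 μ h k) {j : ℕ}
    (hj : (j : ℕ∞) < ladderTime f0 f1 (shift k ω)) :
    decusum f0 f1 μ h (k + j) ω = walk f0 f1 j (shift k ω) := by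
  induction j with
  | zero => simpa [walk] using decusum_eq_zero_of_renewal hω
  | succ j ih =>
    obtain ⟨h1, h2⟩ := succ_lt_ladderTime_iff.1 hj
    have h3 := ih h1
    rw [← add_assoc]
    simp only [decusum]
    rw [h3, if_pos (walk_nonneg_of_lt h1), show ω (k + j) = shift k ω j from rfl, ← walk_succ,
      trunc_of_nonneg h2]

/-- Observation `n + 1` is used if and only if the latest cycle that began at a time `k ≤ n` has not
reached its ladder epoch by time `n`. -/
lemma sum_indicator_renewalEvent (n : ℕ) (ω : ℕ → 𝓧) :
    ∑ k ∈ Finset.range (n + 1), (renewalEvent f0 f1 μ h k ∩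
        {ω | ((n - k : ℕ) : ℕ∞) < ladderTime f0 f1 (shift k ω)}).indicator (1 : (ℕ → 𝓧) → ℝ≥0∞) ω =
      {ω | 0 ≤ decusum f0 f1 μ h n ω}.indicator 1 ω := by
  induction n with
  | zero =>
    have := zero_lt_ladderTime (f0 := f0) (f1 := f1) (shift 0 ω)
    rw [Nat.cast_zero] at this
    simp [renewalEvent, decusum, this]
  | succ n ih =>
    rw [Finset.sum_range_succ]
    have hstep : ∀ k ∈ Finset.range (n + 1), (renewalEvent f0 f1 μ h k ∩
        {ω | ((n + 1 - k : ℕ) : ℕ∞) < ladderTime f0 f1 (shift k ω)}).indicator (1 : (ℕ → 𝓧) → ℝ≥0∞) ω =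
        (renewalEvent f0 f1 μ h k ∩
          {ω | ((n - k : ℕ) : ℕ∞) < ladderTime f0 f1 (shift k ω)}).indicator (1 : (ℕ → 𝓧) → ℝ≥0∞) ω *
          {ω | 0 ≤ decusum f0 f1 μ h n ω + logLR f0 f1 (ω n)}.indicator 1 ω := fun k hk => by
      have hk : k ≤ n := Nat.lt_succ_iff.1 (Finset.mem_range.1 hk)
      have hset : renewalEvent f0 f1 μ h k ∩
          {ω | ((n + 1 - k : ℕ) : ℕ∞) < ladderTime f0 f1 (shift k ω)} =
          (renewalEvent f0 f1 μ h k ∩ {ω | ((n - k : ℕ) : ℕ∞) < ladderTime f0 f1 (shift k ω)}) ∩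
            {ω | 0 ≤ decusum f0 f1 μ h n ω + logLR f0 f1 (ω n)} := by
        ext ω
        simp only [show n + 1 - k = (n - k) + 1 by omega, Set.mem_inter_iff, Set.mem_ofPred_eq,
          succ_lt_ladderTime_iff, and_assoc]
        refine and_congr_right fun h1 => and_congr_right fun h2 => ?_
        have := decusum_eq_walk h1 h2
        rw [Nat.add_sub_cancel' hk] at this
        rw [this, walk_succ, show shift k ω (n - k) = ω n by simp [shift, Nat.add_sub_cancel' hk]]
      rw [hset, Set.inter_indicator_one]
      rfl
    rw [Finset.sum_congr rfl hstep, ← Finset.sum_mul, ih, Nat.sub_self]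
    have hlast : (renewalEvent f0 f1 μ h (n + 1) ∩
        {ω | ((0 : ℕ) : ℕ∞) < ladderTime f0 f1 (shift (n + 1) ω)}) =
        renewalEvent f0 f1 μ h (n + 1) :=
      Set.inter_eq_left.2 fun ω _ => zero_lt_ladderTime _
    rw [hlast]
    by_cases h0 : 0 ≤ decusum f0 f1 μ h n ω
    · by_cases h1 : 0 ≤ decusum f0 f1 μ h n ω + logLR f0 f1 (ω n)
      · simp [Set.indicator, renewalEvent, h0, h1, h1.not_gt, decusum, trunc_of_nonneg h1]
      · simp [Set.indicator, renewalEvent, h0, h1, lt_of_not_ge h1]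
    · simp [Set.indicator, renewalEvent, h0, lt_of_not_ge h0]

lemma measurable_shift (k : ℕ) : Measurable (shift k : (ℕ → 𝓧) → ℕ → 𝓧) :=
  measurable_pi_lambda _ fun i => measurable_pi_apply (k + i)

lemma measurable_walk (hl : Measurable (logLR f0 f1)) (n : ℕ) : Measurable (walk f0 f1 n) :=
  Finset.measurable_fun_sum _ fun i _ => hl.comp (measurable_pi_apply i)

lemma measurableSet_lt_ladderTime (hl : Measurable (logLR f0 f1)) (j : ℕ) :
    MeasurableSet {ω | (j : ℕ∞) < ladderTime f0 f1 ω} := by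
  simp only [ladderTime_eq_hitTime]
  exact measurableSet_lt_hitTime (measurable_add_logLR hl) measurableSet_Iio 0 j

lemma measurableSet_renewalEvent (hl : Measurable (logLR f0 f1)) (k : ℕ) :
    MeasurableSet (renewalEvent f0 f1 μ h k) := by
  cases k with
  | zero => exact MeasurableSet.univ
  | succ n =>
    have hW := measurable_decusum (μ := μ) (h := h) hl n
    refine MeasurableSet.inter (measurableSet_lt (Measurable.ite (measurableSet_decusum_nonneg hl n)
      ?_ hW) measurable_const) (measurableSet_decusum_nonneg hl (n + 1))
    exact hW.add (hl.comp (measurable_pi_apply n))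

lemma splice_mem_renewalEvent (k : ℕ) (ω ω' : ℕ → 𝓧) :
    splice k ω ω' ∈ renewalEvent f0 f1 μ h k ↔ ω ∈ renewalEvent f0 f1 μ h k := by
  cases k with
  | zero => exact Iff.rfl
  | succ n =>
    simp only [renewalEvent, Set.mem_ofPred_eq, decusum_splice (Nat.le_succ n),
      decusum_splice le_rfl, splice_of_lt (Nat.lt_succ_self n)]

/-- A cycle is independent of the past: a mean reward collected at the times when an observation is
used is a convolution of the renewal probabilities with the mean rewards in the first cycle. -/
lemma lintegral_reward (hl : Measurable (logLR f0 f1)) {H : ℝ → 𝓧 → ℝ≥0∞}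
    (hH : Measurable (Function.uncurry H)) (n : ℕ) :
    ∫⁻ ω, {ω | 0 ≤ decusum f0 f1 μ h n ω}.indicator 1 ω * H (decusum f0 f1 μ h n ω) (ω n)
        ∂iidLaw P =
      ∑ k ∈ Finset.range (n + 1), iidLaw P (renewalEvent f0 f1 μ h k) *
        ∫⁻ ω, {ω | ((n - k : ℕ) : ℕ∞) < ladderTime f0 f1 ω}.indicator 1 ω *
          H (walk f0 f1 (n - k) ω) (ω (n - k)) ∂iidLaw P := by
  set Φ : ℕ → (ℕ → 𝓧) → ℝ≥0∞ := fun j ω =>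
    {ω | (j : ℕ∞) < ladderTime f0 f1 ω}.indicator 1 ω * H (walk f0 f1 j ω) (ω j) with hΦ
  have hΦm : ∀ j, Measurable (Φ j) := fun j =>
    (measurable_one.indicator (measurableSet_lt_ladderTime hl j)).mul
      (hH.comp ((measurable_walk hl j).prodMk (measurable_pi_apply j)))
  have hR := fun k => measurableSet_renewalEvent (μ := μ) (h := h) hl k
  have hFm : ∀ k, Measurable fun ω => (renewalEvent f0 f1 μ h k).indicator 1 ω *
      Φ (n - k) (shift k ω) := fun k =>
    (measurable_one.indicator (hR k)).mul ((hΦm _).comp (measurable_shift k))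
  have hpt : ∀ ω, {ω | 0 ≤ decusum f0 f1 μ h n ω}.indicator 1 ω *
      H (decusum f0 f1 μ h n ω) (ω n) =
      ∑ k ∈ Finset.range (n + 1), (renewalEvent f0 f1 μ h k).indicator 1 ω *
        Φ (n - k) (shift k ω) := fun ω => by
    rw [← sum_indicator_renewalEvent, Finset.sum_mul]
    refine Finset.sum_congr rfl fun k hk => ?_
    have hk : k ≤ n := Nat.lt_succ_iff.1 (Finset.mem_range.1 hk)
    by_cases h1 : ω ∈ renewalEvent f0 f1 μ h k
    · by_cases h2 : ((n - k : ℕ) : ℕ∞) < ladderTime f0 f1 (shift k ω)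
      · have h3 := decusum_eq_walk h1 h2
        rw [Nat.add_sub_cancel' hk] at h3
        simp only [hΦ, Set.indicator, Set.mem_inter_iff, Set.mem_ofPred_eq, h1, h2, h3, and_self,
          if_true, Pi.one_apply, one_mul]
        rw [show shift k ω (n - k) = ω n by simp [shift, Nat.add_sub_cancel' hk]]
      · simp only [hΦ, Set.indicator, Set.mem_inter_iff, Set.mem_ofPred_eq, h2, and_false, if_false,
          zero_mul, mul_zero]
    · simp [Set.indicator, h1]
  simp only [hpt]
  rw [lintegral_finsetSum _ fun k _ => hFm k]
  refine Finset.sum_congr rfl fun k _ => ?_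
  rw [lintegral_splice k (hFm k)]
  have hind : ∀ ω ω' : ℕ → 𝓧, (renewalEvent f0 f1 μ h k).indicator (1 : (ℕ → 𝓧) → ℝ≥0∞)
      (splice k ω ω') = (renewalEvent f0 f1 μ h k).indicator 1 ω := fun ω ω' => by
    by_cases hω : ω ∈ renewalEvent f0 f1 μ h k <;> simp [splice_mem_renewalEvent, hω]
  simp only [shift_splice, hind]
  simp_rw [lintegral_const_mul _ (hΦm (n - k))]
  rw [lintegral_mul_const _ (measurable_one.indicator (hR k)), lintegral_indicator_one (hR k)]

/-! The skipped observations are counted through the balance of `remainingSkips`. -/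

lemma remainingSkips_of_nonneg (hμ : 0 < μ) {w : ℝ} (hw : 0 ≤ w) : remainingSkips μ w = 0 := by
  rw [remainingSkips, Nat.ceil_eq_zero, neg_div, neg_nonpos]
  exact div_nonneg hw hμ.le

lemma remainingSkips_of_neg (hμ : 0 < μ) {w : ℝ} (hw : w < 0) :
    remainingSkips μ (min (w + μ) 0) + 1 = remainingSkips μ w := by
  have hx : 0 < -w / μ := div_pos (neg_pos.2 hw) hμ
  have h1 : -(w + μ) / μ = -w / μ - 1 := by field_simp; ring
  rcases le_total (w + μ) 0 with h0 | h0
  · rw [min_eq_left h0, remainingSkips, remainingSkips, h1]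
    have : 0 ≤ -w / μ - 1 := h1 ▸ div_nonneg (by linarith) hμ.le
    rw [← Nat.ceil_add_one this, sub_add_cancel]
  · rw [min_eq_right h0, remainingSkips_of_nonneg hμ le_rfl, remainingSkips, zero_add, eq_comm,
      Nat.ceil_eq_iff one_ne_zero]
    have : -(w + μ) / μ ≤ 0 := div_nonpos_of_nonpos_of_nonneg (by linarith) hμ.le
    constructor
    · simpa using hx
    · rw [h1] at this
      push_cast
      linarith

lemma measurable_remainingSkips : Measurable fun w => (remainingSkips μ w : ℝ≥0∞) := by
  unfold remainingSkips
  fun_prop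

lemma remainingSkips_balance (hμ : 0 < μ) (n : ℕ) (ω : ℕ → 𝓧) :
    (remainingSkips μ (decusum f0 f1 μ h (n + 1) ω) : ℝ≥0∞) +
        {ω | 0 ≤ decusum f0 f1 μ h n ω}ᶜ.indicator 1 ω =
      remainingSkips μ (decusum f0 f1 μ h n ω) +
        {ω | 0 ≤ decusum f0 f1 μ h n ω}.indicator 1 ω *
          remainingSkips μ (trunc h (decusum f0 f1 μ h n ω + logLR f0 f1 (ω n))) := by
  by_cases h0 : 0 ≤ decusum f0 f1 μ h n ω
  · simp [h0, decusum, remainingSkips_of_nonneg hμ h0]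
  · simp only [Set.indicator, Set.mem_compl_iff, Set.mem_ofPred_eq, h0, not_false_eq_true, if_true,
      if_false, zero_mul, add_zero, decusum, ← remainingSkips_of_neg hμ (lt_of_not_ge h0),
      Pi.one_apply]
    push_cast
    rfl

lemma lintegral_remainingSkips_balance (hl : Measurable (logLR f0 f1)) (hμ : 0 < μ) (N : ℕ) :
    ∫⁻ ω, (remainingSkips μ (decusum f0 f1 μ h N ω) : ℝ≥0∞) ∂iidLaw P +
        ∑ n ∈ Finset.range N, iidLaw P {ω | 0 ≤ decusum f0 f1 μ h n ω}ᶜ =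
      ∑ n ∈ Finset.range N, ∫⁻ ω, {ω | 0 ≤ decusum f0 f1 μ h n ω}.indicator 1 ω *
        (remainingSkips μ (trunc h (decusum f0 f1 μ h n ω + logLR f0 f1 (ω n))) : ℝ≥0∞)
          ∂iidLaw P := by
  have hm : ∀ n, Measurable fun ω => (remainingSkips μ (decusum f0 f1 μ h n ω) : ℝ≥0∞) :=
    fun n => measurable_remainingSkips.comp (measurable_decusum hl n)
  induction N with
  | zero => simp [decusum, remainingSkips_of_nonneg hμ]
  | succ n ih =>
    have hs := measurableSet_decusum_nonneg (μ := μ) (h := h) hl n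
    have := lintegral_congr (μ := iidLaw P)
      (remainingSkips_balance (f0 := f0) (f1 := f1) (h := h) hμ n)
    rw [lintegral_add_left (hm (n + 1)), lintegral_add_left (hm n),
      lintegral_indicator_one hs.compl] at this
    rw [Finset.sum_range_succ, Finset.sum_range_succ, ← ih, ← add_assoc, add_right_comm, this]
    ring

/-- The number of observations that are skipped after the first ladder epoch, as a sum over the
possible values of the ladder epoch. -/
lemma ceil_ladderHeight_eq_tsum (hμ : 0 < μ) (ω : ℕ → 𝓧) :
    (⌈|trunc h (ladderHeight f0 f1 ω)| / μ⌉₊ : ℝ≥0∞) =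
      ∑' j : ℕ, {ω | (j : ℕ∞) < ladderTime f0 f1 ω}.indicator 1 ω *
        (remainingSkips μ (trunc h (walk f0 f1 j ω + logLR f0 f1 (ω j))) : ℝ≥0∞) := by
  have hzero : ∀ j : ℕ, ((j + 1 : ℕ) : ℕ∞) < ladderTime f0 f1 ω →
      remainingSkips μ (trunc h (walk f0 f1 j ω + logLR f0 f1 (ω j))) = 0 := fun j hj => by
    rw [← walk_succ, trunc_of_nonneg (walk_nonneg_of_lt hj),
      remainingSkips_of_nonneg hμ (walk_nonneg_of_lt hj)]
  rcases eq_or_ne (ladderTime f0 f1 ω) ⊤ with htop | htop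
  · have h1 : ladderHeight f0 f1 ω = 0 := by simp [ladderHeight, htop, walk]
    rw [h1, trunc_of_nonneg le_rfl]
    simp [hzero, htop, ENat.natCast_lt_top]
  · obtain ⟨N, hN⟩ := ENat.ne_top_iff_exists.1 htop
    have hN0 : N ≠ 0 := by
      rintro rfl
      exact absurd (zero_lt_ladderTime (f0 := f0) (f1 := f1) ω) (by rw [← hN]; simp)
    obtain ⟨n, rfl⟩ := Nat.exists_eq_succ_of_ne_zero hN0
    have hlt : (n : ℕ∞) < ladderTime f0 f1 ω := by
      rw [← hN]
      exact_mod_cast Nat.lt_succ_self n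
    have hneg : walk f0 f1 (n + 1) ω < 0 := by
      by_contra hcon
      have := succ_lt_ladderTime_iff.2 ⟨hlt, not_lt.1 hcon⟩
      rw [← hN] at this
      exact lt_irrefl _ this
    rw [tsum_eq_single n]
    · simp only [Set.indicator, Set.mem_ofPred_eq, hlt, if_true, Pi.one_apply, one_mul,
        remainingSkips]
      rw [← walk_succ, ladderHeight, ← hN, ENat.toNat_natCast,
        abs_of_nonpos (trunc_nonpos (h := h) hneg.le)]
    · intro j hj
      rcases lt_or_ge j n with hjn | hjn
      · rw [hzero j]
        · simp
        · rw [← hN]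
          exact_mod_cast Nat.succ_lt_succ hjn
      · have : ¬ (j : ℕ∞) < ladderTime f0 f1 ω := by
          rw [← hN]
          norm_cast
          omega
        simp [this]

end Renewal

section DutyCycleFormula

variable {ν : Measure 𝓧} [SigmaFinite ν] {f0 f1 : 𝓧 → ℝ} {μ : ℝ}

lemma meanOn_lt_top (hf0 : IsPdf ν f0) (hf1 : IsPdf ν f1)
    (hD0_pos : 0 < InformationTheory.klDiv (law ν f0) (law ν f1))
    (hD0_fin : InformationTheory.klDiv (law ν f0) (law ν f1) < ∞) : meanOn ν f0 f1 < ∞ := by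
  have := hf0.isProbabilityMeasure_law
  have hswap : logLR f0 f1 = fun x => -logLR f1 f0 x := funext fun x => logLR_swap x
  rw [meanOn, noChangeLaw_eq]
  refine lintegral_ladderTime_lt_top (hf0.measurable_logLR hf1) ?_ ?_
  · rw [hswap]
    exact (integrable_logLR hf1 hf0 hD0_fin).neg
  · rw [hswap, integral_neg, integral_logLR hf1 hf0 hD0_fin]
    exact neg_neg_of_pos (ENNReal.toReal_pos hD0_pos.ne' hD0_fin.ne)

lemma meanOff_lt_top (hf0 : IsPdf ν f0) (hμ : 0 < μ) (h : ℝ≥0) :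
    meanOff ν f0 f1 μ h < ∞ := by
  have := hf0.isProbabilityMeasure_law
  rw [meanOff, noChangeLaw_eq]
  refine (lintegral_mono (g := fun _ => (⌈(h : ℝ) / μ⌉₊ : ℝ≥0∞)) fun ω => ?_).trans_lt (by simp)
  have hle : ladderHeight f0 f1 ω ≤ 0 := by
    rcases eq_or_ne (ladderTime f0 f1 ω) ⊤ with htop | htop
    · simp [ladderHeight, htop, walk]
    · obtain ⟨N, hN⟩ := ENat.ne_top_iff_exists.1 htop
      rw [ladderHeight, ← hN, ENat.toNat_natCast]
      by_contra! hcon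
      cases N with
      | zero => simp [walk] at hcon
      | succ n =>
        have := succ_lt_ladderTime_iff.2 ⟨(by rw [← hN]; exact_mod_cast Nat.lt_succ_self n :
          (n : ℕ∞) < ladderTime f0 f1 ω), hcon.le⟩
        rw [← hN] at this
        exact lt_irrefl _ this
  simp only [Nat.cast_le]
  refine Nat.ceil_mono (div_le_div_of_nonneg_right ?_ hμ.le)
  rw [abs_of_nonpos (trunc_nonpos hle), trunc_coe]
  linarith [le_max_right (ladderHeight f0 f1 ω) (-(h : ℝ))]

lemma PDC_decusum_eq (hf0 : IsPdf ν f0) (hf1 : IsPdf ν f1)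
    (hon : meanOn ν f0 f1 < ∞) (hμ : 0 < μ) (h : ℝ≥0) :
    PDC ν f0 f1 (decusumControl f0 f1 μ h) =
      meanOn ν f0 f1 / (meanOn ν f0 f1 + meanOff ν f0 f1 μ h) := by
  have := hf0.isProbabilityMeasure_law
  have hl := hf0.measurable_logLR hf1
  have hoff := meanOff_lt_top (f1 := f1) hf0 hμ h
  set Q := iidLaw (law ν f0) with hQ
  set A : ℕ → ℝ≥0∞ := fun j => Q {ω | (j : ℕ∞) < ladderTime f0 f1 ω} with hA
  set B : ℕ → ℝ≥0∞ := fun j => ∫⁻ ω, {ω | (j : ℕ∞) < ladderTime f0 f1 ω}.indicator 1 ω *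
    (remainingSkips μ (trunc h (walk f0 f1 j ω + logLR f0 f1 (ω j))) : ℝ≥0∞) ∂Q with hB
  have hAsum : ∑' j, A j = meanOn ν f0 f1 := by
    rw [meanOn, noChangeLaw_eq, lintegral_toENNReal (measurableSet_lt_ladderTime hl)]
  have hBsum : ∑' j, B j = meanOff ν f0 f1 μ h := by
    simp only [meanOff, noChangeLaw_eq, ceil_ladderHeight_eq_tsum hμ]
    rw [lintegral_tsum fun j => Measurable.aemeasurable ?_]
    refine (measurable_one.indicator (measurableSet_lt_ladderTime hl j)).mul ?_
    exact measurable_remainingSkips.comp (measurable_trunc.comp ((measurable_walk hl j).add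
      (hl.comp (measurable_pi_apply j))))
  have hBtop : ∀ j, B j ≠ ∞ := fun j => ((ENNReal.le_tsum j).trans_lt (hBsum ▸ hoff)).ne
  have hA1 : 1 ≤ meanOn ν f0 f1 := by
    rw [← hAsum]
    refine le_trans (le_of_eq ?_) (ENNReal.le_tsum 0)
    have : {ω : ℕ → 𝓧 | ((0 : ℕ) : ℕ∞) < ladderTime f0 f1 ω} = Set.univ :=
      Set.eq_univ_of_forall zero_lt_ladderTime
    simp only [hA, this, measure_univ]
  have hA1' : 0 < (meanOn ν f0 f1).toReal :=
    ENNReal.toReal_pos (zero_lt_one.trans_le hA1).ne' hon.ne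
  have hAhas : HasSum (fun j => (A j).toReal) (meanOn ν f0 f1).toReal := by
    rw [← hAsum, ENNReal.tsum_toReal_eq fun j => measure_ne_top _ _]
    exact ENNReal.hasSum_toReal (hAsum ▸ hon.ne)
  have hBhas : HasSum (fun j => (B j).toReal) (meanOff ν f0 f1 μ h).toReal := by
    rw [← hBsum, ENNReal.tsum_toReal_eq hBtop]
    exact ENNReal.hasSum_toReal (hBsum ▸ hoff.ne)
  have hsum0 : (meanOn ν f0 f1).toReal + (meanOff ν f0 f1 μ h).toReal ≠ 0 :=
    (add_pos_of_pos_of_nonneg hA1' ENNReal.toReal_nonneg).ne'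
  have hW := fun n => measurableSet_decusum_nonneg (f0 := f0) (f1 := f1) (μ := μ) (h := h) hl n
  have hreward1 := fun n => lintegral_reward (P := law ν f0) (μ := μ) (h := h) hl
    (H := fun _ _ => 1) measurable_const n
  have hreward2 := fun n => lintegral_reward (P := law ν f0) (μ := μ) (h := h) hl
    (H := fun w x => (remainingSkips μ (trunc h (w + logLR f0 f1 x)) : ℝ≥0∞))
    (measurable_remainingSkips.comp (measurable_trunc.comp (measurable_add_logLR hl))) n
  simp only [mul_one, lintegral_indicator_one (measurableSet_lt_ladderTime hl _),
    lintegral_indicator_one (hW _)] at hreward1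
  have hbal := fun N => lintegral_remainingSkips_balance (P := law ν f0) (f0 := f0) (f1 := f1)
    (h := h) hl hμ N
  simp only [hreward2] at hbal
  set e : ℕ → ℝ≥0∞ := fun N => ∫⁻ ω, (remainingSkips μ (decusum f0 f1 μ h N ω) : ℝ≥0∞) ∂Q with he
  have hele : ∀ N, e N ≤ (⌈(h : ℝ) / μ⌉₊ : ℝ≥0∞) := fun N => by
    refine (lintegral_mono (g := fun _ => (⌈(h : ℝ) / μ⌉₊ : ℝ≥0∞)) fun ω => ?_).trans (by simp)
    simp only [Nat.cast_le, remainingSkips]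
    refine Nat.ceil_mono (div_le_div_of_nonneg_right ?_ hμ.le)
    linarith [neg_le_decusum (f0 := f0) (f1 := f1) (h := h) hμ N ω]
  have hetop : ∀ N, e N ≠ ∞ := fun N => ((hele N).trans_lt (ENNReal.natCast_lt_top _)).ne
  rw [PDC_eq_of_tendsto hf0 hf1 (tendsto_average_of_renewal
    (u := fun k => Q.real (renewalEvent f0 f1 μ h k)) (a := fun j => (A j).toReal)
    (b := fun j => (B j).toReal) (e := fun N => (e N).toReal) (c := (⌈(h : ℝ) / μ⌉₊ : ℝ))
    (fun _ => measureReal_nonneg) (fun _ => measureReal_le_one)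
    hAhas hBhas hsum0 (fun _ => ENNReal.toReal_nonneg)
    (fun N => ?_) (fun n => ?_) fun N => ?_)]
  · rw [ENNReal.ofReal_div_of_pos (lt_of_le_of_ne (by positivity) hsum0.symm),
      ENNReal.ofReal_add ENNReal.toReal_nonneg ENNReal.toReal_nonneg,
      ENNReal.ofReal_toReal hon.ne, ENNReal.ofReal_toReal hoff.ne]
  · exact ENNReal.toReal_le_of_le_ofReal (Nat.cast_nonneg _) (by simpa using hele N)
  · rw [measureReal_def, hreward1 n, ENNReal.toReal_sum fun k _ =>
      ENNReal.mul_ne_top (measure_ne_top _ _) (measure_ne_top _ _)]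
    simp only [ENNReal.toReal_mul]
    rfl
  · have h1 := congrArg ENNReal.toReal (hbal N)
    rw [ENNReal.toReal_add (hetop N) (ENNReal.sum_ne_top.2 fun _ _ => measure_ne_top _ _),
      ENNReal.toReal_sum fun _ _ => measure_ne_top _ _,
      ENNReal.toReal_sum fun n _ => ENNReal.sum_ne_top.2 fun k _ =>
        ENNReal.mul_ne_top (measure_ne_top _ _) (hBtop _)] at h1
    have h2 : ∀ n, 1 - Q.real {ω | 0 ≤ decusum f0 f1 μ h n ω} =
        (Q {ω | 0 ≤ decusum f0 f1 μ h n ω}ᶜ).toReal := fun n =>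
      (probReal_compl_eq_one_sub (hW n)).symm
    rw [Finset.sum_congr rfl fun n _ => h2 n, h1]
    refine Finset.sum_congr rfl fun n _ => ?_
    rw [ENNReal.toReal_sum fun k _ => ENNReal.mul_ne_top (measure_ne_top _ _) (hBtop _)]
    simp only [ENNReal.toReal_mul]
    rfl

end DutyCycleFormula

/-! ### The false alarm rate -/

section FalseAlarm

variable {ν : Measure 𝓧} {f0 f1 : 𝓧 → ℝ}

lemma FAR_decusum_le {μ : ℝ} {h : ℝ≥0∞} (A : ℝ) :
    FAR ν f0 f1 (decusumTime f0 f1 μ h A) ≤ FAR ν f0 f1 (cusumTime f0 f1 A) :=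
  ENNReal.div_le_div_left (lintegral_mono fun ω =>
    ENat.toENNReal_le.2 (cusumTime_le_decusumTime A ω)) 1

lemma FAR_cusum_le [SigmaFinite ν] (hf0 : IsPdf ν f0) (hf1 : IsPdf ν f1) (h10 : law ν f1 ≪ law ν f0)
    (h01 : law ν f0 ≪ law ν f1) {α : ℝ} (hα0 : 0 < α) (hα1 : α ≤ 1) :
    FAR ν f0 f1 (cusumTime f0 f1 |Real.log α|) ≤ ENNReal.ofReal α := by
  have := hf0.isProbabilityMeasure_law
  rw [FAR, noChangeLaw_eq, one_div, ENNReal.inv_le_iff_inv_le, ← ENNReal.ofReal_inv_of_pos hα0]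
  rcases hα1.eq_or_lt with rfl | hα1
  · refine le_trans (le_of_eq (by simp)) (lintegral_mono (f := fun _ => 1) fun ω => ?_)
    have : (1 : ℕ∞) ≤ cusumTime f0 f1 |Real.log 1| ω :=
      le_iInf₂ fun n hn => by exact_mod_cast hn.1
    simpa using ENat.toENNReal_le.2 this
  · have hlog : |Real.log α| = -Real.log α := abs_of_neg (Real.log_neg hα0 hα1)
    have := exp_le_lintegral_cusumTime (hf0.measurable_logLR hf1)
      (lintegral_exp_logLR_le hf0 hf1 h10 h01) (A := |Real.log α|)
      (abs_pos.2 (Real.log_neg hα0 hα1).ne)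
    rwa [hlog, Real.exp_neg, Real.exp_log hα0, ← hlog] at this

end FalseAlarm

end QCD

end

theorem theorem1 {𝓧 : Type*} [MeasurableSpace 𝓧] (ν : Measure 𝓧) [SigmaFinite ν]
    (f0 f1 : 𝓧 → ℝ) (hf0 : QCD.IsPdf ν f0) (hf1 : QCD.IsPdf ν f1)
    (hD1_pos : 0 < InformationTheory.klDiv (QCD.law ν f1) (QCD.law ν f0))
    (hD1_fin : InformationTheory.klDiv (QCD.law ν f1) (QCD.law ν f0) < ∞)
    (hD0_pos : 0 < InformationTheory.klDiv (QCD.law ν f0) (QCD.law ν f1))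
    (hD0_fin : InformationTheory.klDiv (QCD.law ν f0) (QCD.law ν f1) < ∞)
    (μ : ℝ) (hμ : 0 < μ) :
    (∀ h : ℝ≥0,
      (∀ α : ℝ, 0 < α → α ≤ 1 →
        QCD.FAR ν f0 f1 (QCD.decusumTime f0 f1 μ h |Real.log α|) ≤
            QCD.FAR ν f0 f1 (QCD.cusumTime f0 f1 |Real.log α|) ∧
          QCD.FAR ν f0 f1 (QCD.cusumTime f0 f1 |Real.log α|) ≤ ENNReal.ofReal α) ∧
      (QCD.meanOn ν f0 f1 < ∞ ∧ QCD.meanOff ν f0 f1 μ h < ∞ ∧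
        QCD.PDC ν f0 f1 (QCD.decusumControl f0 f1 μ h) =
          QCD.meanOn ν f0 f1 / (QCD.meanOn ν f0 f1 + QCD.meanOff ν f0 f1 μ h)) ∧
      ((fun α : ℝ => (QCD.WADD ν f0 f1 (QCD.decusumTime f0 f1 μ h |Real.log α|)
            (QCD.decusumControl f0 f1 μ h)).toReal) ~[𝓝[>] 0]
          (fun α : ℝ => (QCD.WADD ν f0 f1 (QCD.cusumTime f0 f1 |Real.log α|)
            QCD.cusumControl).toReal) ∧
        (fun α : ℝ => (QCD.WADD ν f0 f1 (QCD.cusumTime f0 f1 |Real.log α|)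
            QCD.cusumControl).toReal) ~[𝓝[>] 0]
          (fun α : ℝ => |Real.log α| /
            (InformationTheory.klDiv (QCD.law ν f1) (QCD.law ν f0)).toReal))) ∧
    QCD.PDC ν f0 f1 (QCD.decusumControl f0 f1 μ ∞) ≤
      ENNReal.ofReal
        (μ / (μ + (InformationTheory.klDiv (QCD.law ν f0) (QCD.law ν f1)).toReal)) := by
  have h10 := (InformationTheory.klDiv_ne_top_iff.1 hD1_fin.ne).1
  have h01 := (InformationTheory.klDiv_ne_top_iff.1 hD0_fin.ne).1
  have hon := QCD.meanOn_lt_top hf0 hf1 hD0_pos hD0_fin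
  have hW := QCD.WADD_decusum_isEquivalent hf0 hf1 hD1_pos hD1_fin hD0_fin hμ
  have hC : (fun α : ℝ => (QCD.WADD ν f0 f1 (QCD.cusumTime f0 f1 |Real.log α|)
      QCD.cusumControl).toReal) ~[𝓝[>] 0] (fun α : ℝ => |Real.log α| /
        (InformationTheory.klDiv (QCD.law ν f1) (QCD.law ν f0)).toReal) := by
    simp only [QCD.WADD_cusum_eq (μ := μ)]
    exact hW 0
  exact ⟨fun h => ⟨fun α hα0 hα1 => ⟨QCD.FAR_decusum_le _,
      QCD.FAR_cusum_le hf0 hf1 h10 h01 hα0 hα1⟩,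
    ⟨hon, QCD.meanOff_lt_top hf0 hμ h, QCD.PDC_decusum_eq hf0 hf1 hon hμ h⟩,
    (hW h).trans hC.symm, hC⟩, QCD.PDC_decusum_top_le hf0 hf1 hD0_fin hμ⟩
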